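/- There exist functions $a,b,c\in C^\infty(\mathbb{R}^5)$ such that each of the following two alternatives is realised by some $f\in C^\infty(\mathbb{R}^5)$ for which the planar Monge–Ampère equation $$(u_{xx}+a)(u_{yy}+c)-(u_{xy}+b)^2=f,$$ where $a,b,c,f$ are evaluated at $(x,y,u,u_x,u_y)$, has no real-valued $C^3$ solution $u=u(x,y)$ in any neighbourhood of the origin of $\mathbb{R}^2$: 1. (mixed type) $f$ changes sign at the origin: for all $z,r,q\in\mathbb{R}$, $f$ takes both positive and negative values in every neighbourhood of the point $(0,0,z,r,q)$; 2. (degenerate hyperbolic) $f\le 0$ on $\mathbb{R}^5$ and, for all $z,r,q\in\mathbb{R}$, $f(0,0,z,r,q)=0$ and $f$ takes negative values in every neighbourhood of $(0,0,z,r,q)$. -/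

import Mathlib

open scoped ContDiff Topology

namespace MongeAmpere

/-- The partial derivative `u_x` of a function `u(x, y)` on the plane. -/
noncomputable def dx (u : ℝ × ℝ → ℝ) (p : ℝ × ℝ) : ℝ := fderiv ℝ u p (1, 0)

/-- The partial derivative `u_y` of a function `u(x, y)` on the plane. -/
noncomputable def dy (u : ℝ × ℝ → ℝ) (p : ℝ × ℝ) : ℝ := fderiv ℝ u p (0, 1)

/-- The space `ℝ⁵` of the variables `(x, y, u, u_x, u_y)`. -/
abbrev R5 : Type := ℝ × ℝ × ℝ × ℝ × ℝ

/-- The point `(x, y, u, u_x, u_y)` of `ℝ⁵` given by `u` at `p = (x, y)`. -/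
noncomputable def jet (u : ℝ × ℝ → ℝ) (p : ℝ × ℝ) : R5 :=
  (p.1, p.2, u p, dx u p, dy u p)

/-- `u` is a `C³` solution on the open set `U` of the Monge–Ampère equation
`(u_xx + a)(u_yy + c) - (u_xy + b)² = f`, where `a, b, c, f` are evaluated at
`(x, y, u, u_x, u_y)`. -/
def IsC3SolutionOn (a b c f : R5 → ℝ) (u : ℝ × ℝ → ℝ) (U : Set (ℝ × ℝ)) : Prop :=
  ContDiffOn ℝ 3 u U ∧
    ∀ p ∈ U,
      (dx (dx u) p + a (jet u p)) * (dy (dy u) p + c (jet u p))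
        - (dy (dx u) p + b (jet u p)) ^ 2 = f (jet u p)

/-- The equation has no `C³` solution in any (open) neighbourhood of the origin of the plane. -/
def NoLocalC3Solution (a b c f : R5 → ℝ) : Prop :=
  ∀ U : Set (ℝ × ℝ), IsOpen U → (0, 0) ∈ U → ¬ ∃ u : ℝ × ℝ → ℝ, IsC3SolutionOn a b c f u U

/-- Mixed type at the origin: whatever the values `z, r, q` of `u, u_x, u_y` there, `f` takes
both positive and negative values arbitrarily close to `(0, 0, z, r, q)`. -/
def IsSignChanging (f : R5 → ℝ) : Prop :=
  ∀ z r q : ℝ,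
    (∃ᶠ w in 𝓝 ((0, 0, z, r, q) : R5), 0 < f w) ∧ (∃ᶠ w in 𝓝 ((0, 0, z, r, q) : R5), f w < 0)

/-- Degenerate hyperbolic at the origin: `f` is nonpositive everywhere and, whatever the values
`z, r, q` of `u, u_x, u_y` at the origin, `f` vanishes at `(0, 0, z, r, q)` and takes negative
values arbitrarily close to that point. -/
def IsDegenerateHyperbolic (f : R5 → ℝ) : Prop :=
  (∀ w : R5, f w ≤ 0) ∧
    ∀ z r q : ℝ, f (0, 0, z, r, q) = 0 ∧ ∃ᶠ w in 𝓝 ((0, 0, z, r, q) : R5), f w < 0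

end MongeAmpere

/-! All data are sums of pieces living over disjoint squares centred at `(2⁻ⁿ, 0)`, the `n`-th piece
having derivatives up to order `n` bounded by `2⁻ⁿ`, so that the sums are smooth. Near the origin a
`C³` solution has the relevant derivatives bounded by `N = n + 1` on the `n`-th square once `n` is
large. It therefore suffices that each square rule out solutions bounded by `N`. Two mechanisms do
this.

Inner square. Put `a = h_x` and `2b = h_y` with `h` supported near the centre. Then `det D²u + h_x
u_yy - h_y u_xy` is a divergence, so the equation bounds `∫ b²` over a middle square by boundary
terms plus small contributions of `c` and `f` (`Jet3.integral_sq_le`). In the surrounding ring `a =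
b = 0` and `f = -R⁻⁷`, so if `u_xx` is small on the boundary of the middle square then so is `u_xy`.
This makes `∫ b²` too small, since `b` was fixed before the other parameters. Inside, only a lower
bound on `f` is used: raising `f` there to a positive value gives the mixed type, leaving it gives
the hyperbolic type, with the same `a, b, c`.

Ring. It remains to force `u_xx` to be small (`Jet3.abs_uxx_lt`). Where `u_xx ≠ 0`, take `(P, y) =
(u_x, y)` as coordinates. The partial Legendre transform `v = x u_x - u` has `v_P = x`, and the
equation becomes `v_yy - R⁻⁷ v_PP = c`. With `c = ε cos(phase) + β x + γ (x u_x - u)` this is a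
linear hyperbolic equation for `v` with source `ε cos(phase)`. The coefficients `β, γ` are such that
a Gaussian wave packet with the same phase solves the transposed homogeneous equation. Testing
against the truncated packet, the source contributes at least `ε R⁻⁸ / 64`, whereas the truncation
error is exponentially small in `R` (`Jet3.source_le`). As `ε` is a fixed negative power of `R`,
this is impossible for large `R`. The value of `u_x` is not known beforehand, so the packet
coefficients are repeated periodically in `u_x` and `y`. -/

namespace MongeAmpere

open Set MeasureTheory

/-! ### Calculus of partial derivatives in the plane -/

/-- `f` is differentiable at `z`, with partial derivatives `a` and `b`. -/
def HasGrad (f : ℝ × ℝ → ℝ) (z : ℝ × ℝ) (a b : ℝ) : Prop :=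
  HasFDerivAt f (a • ContinuousLinearMap.fst ℝ ℝ ℝ + b • ContinuousLinearMap.snd ℝ ℝ ℝ) z

namespace HasGrad

variable {f g : ℝ × ℝ → ℝ} {z : ℝ × ℝ} {a b c d : ℝ}

theorem congr_grad (h : HasGrad f z a b) (ha : a = c) (hb : b = d) : HasGrad f z c d := by
  subst ha hb; exact h

theorem add (hf : HasGrad f z a b) (hg : HasGrad g z c d) :
    HasGrad (fun w => f w + g w) z (a + c) (b + d) := by
  refine (HasFDerivAt.fun_add hf hg).congr_fderiv ?_
  ext <;> simp

theorem neg (hf : HasGrad f z a b) : HasGrad (fun w => -f w) z (-a) (-b) := by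
  refine (HasFDerivAt.fun_neg hf).congr_fderiv ?_
  ext <;> simp

theorem sub (hf : HasGrad f z a b) (hg : HasGrad g z c d) :
    HasGrad (fun w => f w - g w) z (a - c) (b - d) := by
  simpa only [sub_eq_add_neg] using hf.add hg.neg

theorem mul (hf : HasGrad f z a b) (hg : HasGrad g z c d) :
    HasGrad (fun w => f w * g w) z (a * g z + f z * c) (b * g z + f z * d) := by
  refine (HasFDerivAt.fun_mul hf hg).congr_fderiv ?_
  ext <;> simp <;> ring

theorem const (z : ℝ × ℝ) (k : ℝ) : HasGrad (fun _ => k) z 0 0 := by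
  refine (hasFDerivAt_const k z).congr_fderiv ?_
  ext <;> simp

theorem fst (z : ℝ × ℝ) : HasGrad (fun w => w.1) z 1 0 := by
  refine (hasFDerivAt_fst (𝕜 := ℝ)).congr_fderiv ?_
  ext <;> simp

theorem snd (z : ℝ × ℝ) : HasGrad (fun w => w.2) z 0 1 := by
  refine (hasFDerivAt_snd (𝕜 := ℝ)).congr_fderiv ?_
  ext <;> simp

/-- The chain rule for a function of `(f z, z.2)`. -/
theorem comp_snd {w : ℝ × ℝ → ℝ} (hf : HasGrad f z a b) (hw : HasGrad w (f z, z.2) c d) :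
    HasGrad (fun t => w (f t, t.2)) z (c * a) (c * b + d) := by
  have h2 : HasFDerivAt (fun t : ℝ × ℝ => (f t, t.2)) _ z :=
    HasFDerivAt.prodMk hf (hasFDerivAt_snd (𝕜 := ℝ))
  refine (HasFDerivAt.comp (f := fun t : ℝ × ℝ => (f t, t.2)) z hw h2).congr_fderiv ?_
  ext <;> simp

theorem continuousAt (h : HasGrad f z a b) : ContinuousAt f z := HasFDerivAt.continuousAt h

theorem hasDerivAt_fst (h : HasGrad f z a b) : HasDerivAt (fun x => f (x, z.2)) a z.1 := by
  have := HasFDerivAt.comp_hasDerivAt (x := z.1) (f := fun x => (x, z.2)) (l := f) (l' := _)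
    h ((hasDerivAt_id z.1).prodMk (hasDerivAt_const z.1 z.2))
  simpa [Function.comp_def] using this

theorem hasDerivAt_snd (h : HasGrad f z a b) : HasDerivAt (fun y => f (z.1, y)) b z.2 := by
  have := HasFDerivAt.comp_hasDerivAt (x := z.2) (f := fun y => (z.1, y)) (l := f) (l' := _)
    h ((hasDerivAt_const z.2 z.1).prodMk (hasDerivAt_id z.2))
  simpa [Function.comp_def] using this

/-- A product of functions of one variable. -/
theorem prod_mul {s t : ℝ → ℝ} (hs : HasDerivAt s a z.1) (ht : HasDerivAt t b z.2) :
    HasGrad (fun w => s w.1 * t w.2) z (a * t z.2) (s z.1 * b) := by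
  have h1 : HasFDerivAt (fun w : ℝ × ℝ => s w.1) _ z :=
    hs.hasFDerivAt.comp z (hasFDerivAt_fst (𝕜 := ℝ))
  have h2 : HasFDerivAt (fun w : ℝ × ℝ => t w.2) _ z :=
    ht.hasFDerivAt.comp z (hasFDerivAt_snd (𝕜 := ℝ))
  refine (h1.fun_mul h2).congr_fderiv ?_
  ext <;> simp [mul_comm]

/-- A function of one variable composed with a function of two variables. -/
theorem comp_left {s : ℝ → ℝ} (hs : HasDerivAt s c (f z)) (hf : HasGrad f z a b) :
    HasGrad (fun w => s (f w)) z (c * a) (c * b) := by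
  refine (hs.hasFDerivAt.comp z hf).congr_fderiv ?_
  ext <;> simp [mul_comm]

end HasGrad

/-! ### Third-order jets of solutions -/

/-- The derivatives up to order three of a `C³` function `u` on the set `U`. -/
structure Jet3 (U : Set (ℝ × ℝ)) (u p q E F G Ex Ey Fy Gy : ℝ × ℝ → ℝ) : Prop where
  hu : ∀ z ∈ U, HasGrad u z (p z) (q z)
  hp : ∀ z ∈ U, HasGrad p z (E z) (F z)
  hq : ∀ z ∈ U, HasGrad q z (F z) (G z)
  hE : ∀ z ∈ U, HasGrad E z (Ex z) (Ey z)
  hF : ∀ z ∈ U, HasGrad F z (Ey z) (Fy z)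
  hG : ∀ z ∈ U, HasGrad G z (Fy z) (Gy z)
  cEx : ContinuousOn Ex U
  cEy : ContinuousOn Ey U
  cFy : ContinuousOn Fy U

theorem hasGrad_of_contDiffOn {f : ℝ × ℝ → ℝ} {U : Set (ℝ × ℝ)} (hU : IsOpen U) {n : ℕ∞}
    (hn : 1 ≤ n) (hf : ContDiffOn ℝ n f U) {z : ℝ × ℝ} (hz : z ∈ U) :
    HasGrad f z (dx f z) (dy f z) := by
  have h := ((hf.differentiableOn (by simpa using (by positivity : n ≠ 0))).differentiableAt
    (hU.mem_nhds hz)).hasFDerivAt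
  refine h.congr_fderiv ?_
  ext <;> simp [dx, dy]

theorem contDiffOn_dx {f : ℝ × ℝ → ℝ} {U : Set (ℝ × ℝ)} (hU : IsOpen U) {n : ℕ}
    (hf : ContDiffOn ℝ (n + 1 : ℕ) f U) : ContDiffOn ℝ n (dx f) U :=
  (hf.fderiv_of_isOpen hU (m := n) (by norm_cast)).clm_apply contDiffOn_const

theorem contDiffOn_dy {f : ℝ × ℝ → ℝ} {U : Set (ℝ × ℝ)} (hU : IsOpen U) {n : ℕ}
    (hf : ContDiffOn ℝ (n + 1 : ℕ) f U) : ContDiffOn ℝ n (dy f) U :=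
  (hf.fderiv_of_isOpen hU (m := n) (by norm_cast)).clm_apply contDiffOn_const

theorem dx_dy_comm {f : ℝ × ℝ → ℝ} {U : Set (ℝ × ℝ)} (hU : IsOpen U)
    (hf : ContDiffOn ℝ 2 f U) {z : ℝ × ℝ} (hz : z ∈ U) : dx (dy f) z = dy (dx f) z := by
  have h2 : ContDiffAt ℝ 2 f z := hf.contDiffAt (hU.mem_nhds hz)
  have hs : IsSymmSndFDerivAt ℝ f z := h2.isSymmSndFDerivAt (by simp)
  have hd : DifferentiableAt ℝ (fderiv ℝ f) z :=
    (h2.fderiv_right (m := 1) (by norm_num)).differentiableAt (by simp)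
  have key : ∀ v w : ℝ × ℝ, fderiv ℝ (fun p => fderiv ℝ f p v) z w
      = fderiv ℝ (fderiv ℝ f) z w v := by
    intro v w
    rw [fderiv_clm_apply hd (differentiableAt_const v)]
    simp
  unfold dx dy
  rw [key, key]
  exact hs _ _

/-- Symmetry of second derivatives, used for `u`, `u_x` and `u_y`, gives `F_x = E_y` and `G_x =
F_y`. These relations cancel the third derivatives in the divergence identities. -/
theorem jet3_of_contDiffOn {u : ℝ × ℝ → ℝ} {U : Set (ℝ × ℝ)} (hU : IsOpen U)
    (hu : ContDiffOn ℝ 3 u U) :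
    Jet3 U u (dx u) (dy u) (dx (dx u)) (dy (dx u)) (dy (dy u))
      (dx (dx (dx u))) (dy (dx (dx u))) (dy (dy (dx u))) (dy (dy (dy u))) := by
  have hp : ContDiffOn ℝ 2 (dx u) U := contDiffOn_dx (n := 2) hU hu
  have hq : ContDiffOn ℝ 2 (dy u) U := contDiffOn_dy (n := 2) hU hu
  have hE : ContDiffOn ℝ 1 (dx (dx u)) U := contDiffOn_dx (n := 1) hU hp
  have hF : ContDiffOn ℝ 1 (dy (dx u)) U := contDiffOn_dy (n := 1) hU hp
  have hG : ContDiffOn ℝ 1 (dy (dy u)) U := contDiffOn_dy (n := 1) hU hq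
  have hu2 : ContDiffOn ℝ 2 u U := hu.of_le (by norm_num)
  have hpq : ∀ z ∈ U, dx (dy u) z = dy (dx u) z := fun z hz => dx_dy_comm hU hu2 hz
  have hFG : ∀ z ∈ U, dx (dy (dy u)) z = dy (dy (dx u)) z := by
    intro z hz
    rw [dx_dy_comm hU hq hz]
    have : dx (dy u) =ᶠ[𝓝 z] dy (dx u) := by
      filter_upwards [hU.mem_nhds hz] with w hw using hpq w hw
    unfold dy at this ⊢
    rw [this.fderiv_eq]
  refine ⟨fun z hz => hasGrad_of_contDiffOn hU (n := 3) (by norm_num) hu hz,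
    fun z hz => hasGrad_of_contDiffOn hU (n := 2) (by norm_num) hp hz, fun z hz => ?_,
    fun z hz => hasGrad_of_contDiffOn hU (n := 1) le_rfl hE hz, fun z hz => ?_, fun z hz => ?_,
    (contDiffOn_dx (n := 0) hU hE).continuousOn, (contDiffOn_dy (n := 0) hU hE).continuousOn,
    (contDiffOn_dy (n := 0) hU hF).continuousOn⟩
  · rw [← hpq z hz]
    exact hasGrad_of_contDiffOn hU (n := 2) (by norm_num) hq hz
  · rw [← dx_dy_comm hU hp hz]
    exact hasGrad_of_contDiffOn hU (n := 1) le_rfl hF hz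
  · rw [← hFG z hz]
    exact hasGrad_of_contDiffOn hU (n := 1) le_rfl hG hz

/-! ### Divergence identities for the Monge–Ampère operator -/

/-- The divergence theorem on a rectangle. -/
theorem integral_div_rect {X Y Xx Xy Yx Yy : ℝ × ℝ → ℝ} {a₁ b₁ a₂ b₂ : ℝ}
    (h₁ : a₁ ≤ b₁) (h₂ : a₂ ≤ b₂)
    (hX : ∀ z ∈ Icc a₁ b₁ ×ˢ Icc a₂ b₂, HasGrad X z (Xx z) (Xy z))
    (hY : ∀ z ∈ Icc a₁ b₁ ×ˢ Icc a₂ b₂, HasGrad Y z (Yx z) (Yy z))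
    (hc : ContinuousOn (fun z => Xx z + Yy z) (Icc a₁ b₁ ×ˢ Icc a₂ b₂)) :
    ∫ z in Icc a₁ b₁ ×ˢ Icc a₂ b₂, (Xx z + Yy z) =
      ((∫ x in a₁..b₁, Y (x, b₂)) - ∫ x in a₁..b₁, Y (x, a₂)) +
        (∫ y in a₂..b₂, X (b₁, y)) - ∫ y in a₂..b₂, X (a₁, y) := by
  have hI : Icc a₁ b₁ ×ˢ Icc a₂ b₂ = Icc (a₁, a₂) (b₁, b₂) := Icc_prod_Icc a₁ b₁ a₂ b₂
  have key := integral_divergence_prod_Icc_of_hasFDerivAt_of_le X Y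
    (fun z => Xx z • ContinuousLinearMap.fst ℝ ℝ ℝ + Xy z • ContinuousLinearMap.snd ℝ ℝ ℝ)
    (fun z => Yx z • ContinuousLinearMap.fst ℝ ℝ ℝ + Yy z • ContinuousLinearMap.snd ℝ ℝ ℝ)
    (a₁, a₂) (b₁, b₂) ⟨h₁, h₂⟩ ?_ ?_ ?_ ?_ ?_
  · rw [← key, ← hI]
    simp
  · rw [← hI]
    exact fun z hz => (hX z hz).continuousAt.continuousWithinAt
  · rw [← hI]
    exact fun z hz => (hY z hz).continuousAt.continuousWithinAt
  · exact fun z hz => hX z ⟨Ioo_subset_Icc_self hz.1, Ioo_subset_Icc_self hz.2⟩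
  · exact fun z hz => hY z ⟨Ioo_subset_Icc_self hz.1, Ioo_subset_Icc_self hz.2⟩
  · rw [← hI]
    refine ContinuousOn.integrableOn_compact (isCompact_Icc.prod isCompact_Icc) ?_
    simpa using hc

theorem integral_rect_eq {g : ℝ × ℝ → ℝ} {a₁ b₁ a₂ b₂ : ℝ} (h₁ : a₁ ≤ b₁)
    (hg : ContinuousOn g (Icc a₁ b₁ ×ˢ Icc a₂ b₂)) :
    IntegrableOn (fun y => ∫ x in a₁..b₁, g (x, y)) (Icc a₂ b₂) ∧
      ∫ z in Icc a₁ b₁ ×ˢ Icc a₂ b₂, g z = ∫ y in Icc a₂ b₂, ∫ x in a₁..b₁, g (x, y) := by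
  have hi : IntegrableOn g (Icc a₁ b₁ ×ˢ Icc a₂ b₂) (volume.prod volume) :=
    hg.integrableOn_compact (isCompact_Icc.prod isCompact_Icc)
  have hi2 := hi
  rw [IntegrableOn, ← Measure.prod_restrict] at hi2
  simp only [intervalIntegral.integral_of_le h₁, ← integral_Icc_eq_integral_Ioc]
  refine ⟨hi2.integral_prod_right, ?_⟩
  rw [Measure.volume_eq_prod, ← Measure.prod_restrict, integral_prod_symm _ hi2]

namespace Jet3

variable {U : Set (ℝ × ℝ)} {u p q E F G Ex Ey Fy Gy : ℝ × ℝ → ℝ}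

theorem continuousOn_all (J : Jet3 U u p q E F G Ex Ey Fy Gy) :
    ContinuousOn u U ∧ ContinuousOn p U ∧ ContinuousOn q U ∧ ContinuousOn E U ∧
      ContinuousOn F U ∧ ContinuousOn G U :=
  ⟨fun z hz => (J.hu z hz).continuousAt.continuousWithinAt,
    fun z hz => (J.hp z hz).continuousAt.continuousWithinAt,
    fun z hz => (J.hq z hz).continuousAt.continuousWithinAt,
    fun z hz => (J.hE z hz).continuousAt.continuousWithinAt,
    fun z hz => (J.hF z hz).continuousAt.continuousWithinAt,
    fun z hz => (J.hG z hz).continuousAt.continuousWithinAt⟩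

/-- The integral of `det D²u + h_x u_yy - h_y u_xy` is a boundary term. -/
theorem integral_det (J : Jet3 U u p q E F G Ex Ey Fy Gy) {h a b : ℝ × ℝ → ℝ}
    {a₁ b₁ a₂ b₂ : ℝ} (h₁ : a₁ ≤ b₁) (h₂ : a₂ ≤ b₂) (hU : Icc a₁ b₁ ×ˢ Icc a₂ b₂ ⊆ U)
    (hh : ∀ z, HasGrad h z (a z) (2 * b z)) (ha : Continuous a) (hb : Continuous b) :
    ∫ z in Icc a₁ b₁ ×ˢ Icc a₂ b₂, (E z * G z - F z ^ 2 + a z * G z - 2 * b z * F z) =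
      ((∫ x in a₁..b₁, (q (x, b₂) * E (x, b₂) - h (x, b₂) * F (x, b₂))) -
        ∫ x in a₁..b₁, (q (x, a₂) * E (x, a₂) - h (x, a₂) * F (x, a₂))) +
      (∫ y in a₂..b₂, (h (b₁, y) * G (b₁, y) - q (b₁, y) * F (b₁, y))) -
        ∫ y in a₂..b₂, (h (a₁, y) * G (a₁, y) - q (a₁, y) * F (a₁, y)) := by
  obtain ⟨cu, cp, cq, cE, cF, cG⟩ := J.continuousOn_all
  -- The field `(h u_yy - u_y u_xy, u_y u_xx - h u_xy)` has the integrand as its divergence.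
  have hX : ∀ z ∈ Icc a₁ b₁ ×ˢ Icc a₂ b₂, HasGrad (fun z => h z * G z - q z * F z) z
      (a z * G z + h z * Fy z - (F z * F z + q z * Ey z)) _ := fun z hz =>
    ((hh z).mul (J.hG z (hU hz))).sub ((J.hq z (hU hz)).mul (J.hF z (hU hz)))
  have hY : ∀ z ∈ Icc a₁ b₁ ×ˢ Icc a₂ b₂, HasGrad (fun z => q z * E z - h z * F z) z
      _ (G z * E z + q z * Ey z - (2 * b z * F z + h z * Fy z)) := fun z hz =>
    ((J.hq z (hU hz)).mul (J.hE z (hU hz))).sub ((hh z).mul (J.hF z (hU hz)))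
  have key := integral_div_rect h₁ h₂ hX hY ?_
  · rw [← key]
    refine integral_congr_ae (Filter.Eventually.of_forall fun z => ?_)
    simp only
    ring
  · have ch : Continuous h := continuous_iff_continuousAt.2 fun z => (hh z).continuousAt
    have := J.cFy
    have := J.cEy
    refine ContinuousOn.mono (s := U) ?_ hU
    fun_prop

/-- If `u_xx` and `u_xy` are small on the boundary of a rectangle, then a solution inside forces
the integral of `b²` to be small. -/
theorem integral_sq_le (J : Jet3 U u p q E F G Ex Ey Fy Gy) {h a b c f : ℝ × ℝ → ℝ}
    {a₁ b₁ a₂ b₂ N e e₁ η : ℝ} (h₁ : a₁ ≤ b₁) (h₂ : a₂ ≤ b₂) (w₁ : b₁ - a₁ ≤ 1)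
    (w₂ : b₂ - a₂ ≤ 1) (hU : Icc a₁ b₁ ×ˢ Icc a₂ b₂ ⊆ U)
    (hh : ∀ z, HasGrad h z (a z) (2 * b z)) (ha : Continuous a) (hb : Continuous b)
    (hN : 0 ≤ N) (he : 0 ≤ e) (he₁ : 0 ≤ e₁) (hη : 0 ≤ η)
    (hqN : ∀ z ∈ Icc a₁ b₁ ×ˢ Icc a₂ b₂, |q z| ≤ N)
    (hEN : ∀ z ∈ Icc a₁ b₁ ×ˢ Icc a₂ b₂, |E z| ≤ N)
    (ha1 : ∀ z ∈ Icc a₁ b₁ ×ˢ Icc a₂ b₂, |a z| ≤ 1)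
    (hc : ∀ z ∈ Icc a₁ b₁ ×ˢ Icc a₂ b₂, |c z| ≤ η)
    (hf : ∀ z ∈ Icc a₁ b₁ ×ˢ Icc a₂ b₂, -η ≤ f z)
    (heq : ∀ z ∈ Icc a₁ b₁ ×ˢ Icc a₂ b₂,
      (E z + a z) * (G z + c z) - (F z + b z) ^ 2 = f z)
    (hbd : ∀ z ∈ Icc a₁ b₁ ×ˢ Icc a₂ b₂, (z.1 = a₁ ∨ z.1 = b₁ ∨ z.2 = a₂ ∨ z.2 = b₂) →
      h z = 0 ∧ |E z| ≤ e ∧ |F z| ≤ e₁) :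
    ∫ z in Icc a₁ b₁ ×ˢ Icc a₂ b₂, b z ^ 2 ≤ 2 * N * e + 2 * N * e₁ + η * (N + 2) := by
  obtain ⟨cu, cp, cq, cE, cF, cG⟩ := J.continuousOn_all
  set K := Icc a₁ b₁ ×ˢ Icc a₂ b₂ with hK
  have hKc : IsCompact K := isCompact_Icc.prod isCompact_Icc
  have hvol : volume.real K ≤ 1 := by
    rw [hK, Measure.volume_eq_prod, measureReal_prod_prod, Real.volume_real_Icc_of_le h₁,
      Real.volume_real_Icc_of_le h₂]
    exact mul_le_one₀ w₁ (by linarith) w₂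
  have key := J.integral_det h₁ h₂ hU hh ha hb
  have hbdx : ∀ y ∈ Icc a₂ b₂, y = a₂ ∨ y = b₂ →
      |∫ x in a₁..b₁, (q (x, y) * E (x, y) - h (x, y) * F (x, y))| ≤ N * e := by
    intro y hy hy'
    rw [← Real.norm_eq_abs]
    refine (intervalIntegral.norm_integral_le_of_norm_le_const (C := N * e) fun x hx => ?_).trans ?_
    · rw [uIoc_of_le h₁] at hx
      have hz : (x, y) ∈ K := ⟨Ioc_subset_Icc_self hx, hy⟩
      obtain ⟨h0, hE0, -⟩ := hbd _ hz (by tauto)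
      rw [h0, zero_mul, sub_zero, Real.norm_eq_abs, abs_mul]
      exact mul_le_mul (hqN _ hz) hE0 (abs_nonneg _) hN
    · rw [abs_of_nonneg (by linarith)]
      exact mul_le_of_le_one_right (by positivity) w₁
  have hbdy : ∀ x ∈ Icc a₁ b₁, x = a₁ ∨ x = b₁ →
      |∫ y in a₂..b₂, (h (x, y) * G (x, y) - q (x, y) * F (x, y))| ≤ N * e₁ := by
    intro x hx hx'
    rw [← Real.norm_eq_abs]
    refine (intervalIntegral.norm_integral_le_of_norm_le_const (C := N * e₁) fun y hy => ?_).trans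
      ?_
    · rw [uIoc_of_le h₂] at hy
      have hz : (x, y) ∈ K := ⟨hx, Ioc_subset_Icc_self hy⟩
      obtain ⟨h0, -, hF0⟩ := hbd _ hz (by tauto)
      rw [h0, zero_mul, zero_sub, norm_neg, Real.norm_eq_abs, abs_mul]
      exact mul_le_mul (hqN _ hz) hF0 (abs_nonneg _) hN
    · rw [abs_of_nonneg (by linarith)]
      exact mul_le_of_le_one_right (by positivity) w₂
  have e1 := abs_le.1 (hbdx b₂ ⟨h₂, le_rfl⟩ (Or.inr rfl))
  have e2 := abs_le.1 (hbdx a₂ ⟨le_rfl, h₂⟩ (Or.inl rfl))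
  have e3 := abs_le.1 (hbdy b₁ ⟨h₁, le_rfl⟩ (Or.inr rfl))
  have e4 := abs_le.1 (hbdy a₁ ⟨le_rfl, h₁⟩ (Or.inl rfl))
  have cdet : ContinuousOn (fun z => E z * G z - F z ^ 2 + a z * G z - 2 * b z * F z) K := by
    refine ContinuousOn.mono (s := U) ?_ hU
    fun_prop
  -- Expanding the equation, `b²` is the divergence term plus `c (E + a) - f`, and these last two
  -- parts are at most `η (N + 1)` and `η`.
  have hle : ∫ z in K, b z ^ 2 ≤
      ∫ z in K, ((E z * G z - F z ^ 2 + a z * G z - 2 * b z * F z) + η * (N + 2)) := by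
    refine setIntegral_mono_on ((hb.pow 2).continuousOn.integrableOn_compact hKc)
      ((cdet.add continuousOn_const).integrableOn_compact hKc) hKc.measurableSet fun z hz => ?_
    have h1 : |c z * (E z + a z)| ≤ η * (N + 1) := by
      rw [abs_mul]
      refine mul_le_mul (hc z hz) ((abs_add_le _ _).trans (add_le_add (hEN z hz) (ha1 z hz)))
        (abs_nonneg _) hη
    have h2 := (abs_le.1 h1).2
    have h3 := hf z hz
    have h4 := heq z hz
    nlinarith
  rw [integral_add (cdet.integrableOn_compact hKc) (continuousOn_const.integrableOn_compact hKc),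
    key, setIntegral_const, smul_eq_mul] at hle
  have : volume.real K * (η * (N + 2)) ≤ η * (N + 2) :=
    mul_le_of_le_one_left (by positivity) hvol
  linarith

/-- The derivatives of a function of two variables up to order two. -/
structure _root_.MongeAmpere.Jet2 (θ θP θy θPP θPy θyy : ℝ × ℝ → ℝ) : Prop where
  h0 : ∀ z, HasGrad θ z (θP z) (θy z)
  hP : ∀ z, HasGrad θP z (θPP z) (θPy z)
  hy : ∀ z, HasGrad θy z (θPy z) (θyy z)
  cPP : Continuous θPP
  cPy : Continuous θPy
  cyy : Continuous θyy

/-- Integration by parts for the Monge–Ampère operator against a function of `(u_x, y)`: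
in the partial Legendre transform `v = x u_x - u` the operator becomes linear. -/
theorem integral_legendre (J : Jet3 U u p q E F G Ex Ey Fy Gy)
    {θ θP θy θPP θPy θyy w wP wy : ℝ × ℝ → ℝ} {κ : ℝ} (T : Jet2 θ θP θy θPP θPy θyy)
    (hw : ∀ z, HasGrad w z (wP z) (wy z)) (cwP : Continuous wP)
    {a₁ b₁ a₂ b₂ : ℝ} (h₁ : a₁ ≤ b₁) (h₂ : a₂ ≤ b₂) (hU : Icc a₁ b₁ ×ˢ Icc a₂ b₂ ⊆ U)
    (hbd : ∀ z ∈ Icc a₁ b₁ ×ˢ Icc a₂ b₂, (z.1 = a₁ ∨ z.1 = b₁ ∨ z.2 = a₂ ∨ z.2 = b₂) →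
      θ (p z, z.2) = 0 ∧ θP (p z, z.2) = 0 ∧ θy (p z, z.2) = 0 ∧ w (p z, z.2) = 0) :
    ∫ z in Icc a₁ b₁ ×ˢ Icc a₂ b₂,
      ((E z * G z - F z ^ 2 + κ) * θ (p z, z.2) + z.1 * E z * w (p z, z.2)
        + (z.1 * p z - u z) * E z * (θyy (p z, z.2) - κ * θPP (p z, z.2) + wP (p z, z.2))) = 0 := by
  obtain ⟨cu, cp, cq, cE, cF, cG⟩ := J.continuousOn_all
  have c0 : Continuous θ := continuous_iff_continuousAt.2 fun z => (T.h0 z).continuousAt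
  have cP : Continuous θP := continuous_iff_continuousAt.2 fun z => (T.hP z).continuousAt
  have cy : Continuous θy := continuous_iff_continuousAt.2 fun z => (T.hy z).continuousAt
  have cw : Continuous w := continuous_iff_continuousAt.2 fun z => (hw z).continuousAt
  have cPP := T.cPP
  have cPy := T.cPy
  have cyy := T.cyy
  have cEy := J.cEy
  have cFy := J.cFy
  have hv : ∀ z ∈ U, HasGrad (fun z => z.1 * p z - u z) z (z.1 * E z) (z.1 * F z - q z) :=
    fun z hz => (((HasGrad.fst z).mul (J.hp z hz)).sub (J.hu z hz)).congr_grad (by ring) (by ring)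
  have t0 : ∀ z ∈ U, HasGrad (fun z => θ (p z, z.2)) z (θP (p z, z.2) * E z)
      (θP (p z, z.2) * F z + θy (p z, z.2)) := fun z hz => (J.hp z hz).comp_snd (T.h0 _)
  have tP : ∀ z ∈ U, HasGrad (fun z => θP (p z, z.2)) z (θPP (p z, z.2) * E z)
      (θPP (p z, z.2) * F z + θPy (p z, z.2)) := fun z hz => (J.hp z hz).comp_snd (T.hP _)
  have ty : ∀ z ∈ U, HasGrad (fun z => θy (p z, z.2)) z (θPy (p z, z.2) * E z)
      (θPy (p z, z.2) * F z + θyy (p z, z.2)) := fun z hz => (J.hp z hz).comp_snd (T.hy _)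
  have tw : ∀ z ∈ U, HasGrad (fun z => w (p z, z.2)) z (wP (p z, z.2) * E z)
      (wP (p z, z.2) * F z + wy (p z, z.2)) := fun z hz => (J.hp z hz).comp_snd (hw _)
  -- In the variables `(P, y)`, Green's identity has flux `A = v w + κ (v_P θ - v θ_P)` and `B = v
  -- θ_y - v_y θ`, with `v_P = x` and `v_y = -q`. Its pullback under `(x, y) ↦ (p, y)` is `(A - F B,
  -- E B)`, which involves no division by `E`, so the identity also holds where `E` vanishes.
  let X : ℝ × ℝ → ℝ := fun z =>
    (z.1 * p z - u z) * w (p z, z.2) + κ * (z.1 * θ (p z, z.2) - (z.1 * p z - u z) * θP (p z, z.2))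
      - (q z * F z * θ (p z, z.2) + (z.1 * p z - u z) * F z * θy (p z, z.2))
  let Y : ℝ × ℝ → ℝ := fun z =>
    q z * E z * θ (p z, z.2) + (z.1 * p z - u z) * E z * θy (p z, z.2)
  have hX : ∀ z ∈ Icc a₁ b₁ ×ˢ Icc a₂ b₂, HasGrad X z _ _ := fun z hz =>
    have hz := hU hz
    ((hv z hz).mul (tw z hz)).add ((HasGrad.const z κ).mul
      (((HasGrad.fst z).mul (t0 z hz)).sub ((hv z hz).mul (tP z hz)))) |>.sub
      ((((J.hq z hz).mul (J.hF z hz)).mul (t0 z hz)).add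
        (((hv z hz).mul (J.hF z hz)).mul (ty z hz)))
  have hY : ∀ z ∈ Icc a₁ b₁ ×ˢ Icc a₂ b₂, HasGrad Y z _ _ := fun z hz =>
    have hz := hU hz
    (((J.hq z hz).mul (J.hE z hz)).mul (t0 z hz)).add
      (((hv z hz).mul (J.hE z hz)).mul (ty z hz))
  have key := integral_div_rect h₁ h₂ hX hY ?_
  · have hYt : ∀ y ∈ Icc a₂ b₂, y = a₂ ∨ y = b₂ → ∫ x in a₁..b₁, Y (x, y) = 0 := by
      intro y hy hy'
      refine (intervalIntegral.integral_congr (g := fun _ => 0) fun x hx => ?_).trans (by simp)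
      rw [uIcc_of_le h₁] at hx
      obtain ⟨g0, gP, gy, gw⟩ := hbd (x, y) ⟨hx, hy⟩ (by tauto)
      simp only at g0 gP gy gw
      simp [Y, g0, gy]
    have hXt : ∀ x ∈ Icc a₁ b₁, x = a₁ ∨ x = b₁ → ∫ y in a₂..b₂, X (x, y) = 0 := by
      intro x hx hx'
      refine (intervalIntegral.integral_congr (g := fun _ => 0) fun y hy => ?_).trans (by simp)
      rw [uIcc_of_le h₂] at hy
      obtain ⟨g0, gP, gy, gw⟩ := hbd (x, y) ⟨hx, hy⟩ (by tauto)
      simp only at g0 gP gy gw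
      simp [X, g0, gy, gP, gw]
    rw [hYt b₂ ⟨h₂, le_rfl⟩ (Or.inr rfl), hYt a₂ ⟨le_rfl, h₂⟩ (Or.inl rfl),
      hXt b₁ ⟨h₁, le_rfl⟩ (Or.inr rfl), hXt a₁ ⟨le_rfl, h₁⟩ (Or.inl rfl)] at key
    rw [sub_zero, add_zero, sub_zero] at key
    rw [← key]
    refine integral_congr_ae (Filter.Eventually.of_forall fun z => ?_)
    simp only
    ring
  · refine ContinuousOn.mono (s := U) ?_ hU
    have cθ : ∀ g : ℝ × ℝ → ℝ, Continuous g → ContinuousOn (fun z => g (p z, z.2)) U :=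
      fun g hg => hg.comp_continuousOn (cp.prodMk continuousOn_snd)
    have d0 := cθ _ c0
    have dP := cθ _ cP
    have dy := cθ _ cy
    have dw := cθ _ cw
    have dwP := cθ _ cwP
    have dPP := cθ _ cPP
    have dPy := cθ _ cPy
    have dyy := cθ _ cyy
    fun_prop

end Jet3

/-! ### The truncated wave packet -/

theorem HasGrad.translate {f : ℝ × ℝ → ℝ} {z c : ℝ × ℝ} {a b : ℝ} (h : HasGrad f (z - c) a b) :
    HasGrad (fun w => f (w - c)) z a b := by
  have := HasFDerivAt.comp (f := fun w => w - c) z h ((hasFDerivAt_id z).sub_const c)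
  simpa [HasGrad, Function.comp_def] using this

theorem Jet2.translate {θ θP θy θPP θPy θyy : ℝ × ℝ → ℝ} (T : Jet2 θ θP θy θPP θPy θyy)
    (c : ℝ × ℝ) : Jet2 (fun z => θ (z - c)) (fun z => θP (z - c)) (fun z => θy (z - c))
      (fun z => θPP (z - c)) (fun z => θPy (z - c)) (fun z => θyy (z - c)) :=
  ⟨fun _ => (T.h0 _).translate, fun _ => (T.hP _).translate, fun _ => (T.hy _).translate,
    T.cPP.comp (continuous_id.sub continuous_const),
    T.cPy.comp (continuous_id.sub continuous_const),
    T.cyy.comp (continuous_id.sub continuous_const)⟩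

/-- A `C²` cutoff function at scale `ℓ`, with its first two derivatives bounded by `M`. -/
structure Cutoff (ℓ M : ℝ) (T T1 T2 : ℝ → ℝ) : Prop where
  h1 : ∀ t, HasDerivAt T (T1 t) t
  h2 : ∀ t, HasDerivAt T1 (T2 t) t
  c2 : Continuous T2
  one : ∀ t, |t| ≤ ℓ / 8 → T t = 1 ∧ T1 t = 0 ∧ T2 t = 0
  zero : ∀ t, 3 * ℓ / 8 ≤ |t| → T t = 0 ∧ T1 t = 0 ∧ T2 t = 0
  nonneg : ∀ t, 0 ≤ T t
  le_one : ∀ t, T t ≤ 1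
  b1 : ∀ t, |T1 t| ≤ M
  b2 : ∀ t, |T2 t| ≤ M

/-- The phase of the wave packet. -/
noncomputable def phase (R : ℝ) (z : ℝ × ℝ) : ℝ := R ^ 4 * z.1 - R / 2 * z.2 ^ 2

/-- The amplitude of the wave packet. -/
noncomputable def amp (R : ℝ) (z : ℝ × ℝ) : ℝ := Real.exp (-(R / 2 * (z.1 ^ 2 + z.2 ^ 2)))

/-- The real part of the wave packet. -/
noncomputable def waveC (R : ℝ) (z : ℝ × ℝ) : ℝ := amp R z * Real.cos (phase R z)

/-- The imaginary part of the wave packet. -/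
noncomputable def waveS (R : ℝ) (z : ℝ × ℝ) : ℝ := amp R z * Real.sin (phase R z)

theorem amp_pos (R : ℝ) (z : ℝ × ℝ) : 0 < amp R z := Real.exp_pos _

section Wave

variable (R : ℝ) (z : ℝ × ℝ)

theorem hasGrad_phase : HasGrad (phase R) z (R ^ 4) (-(R * z.2)) :=
  (((HasGrad.const z (R ^ 4)).mul (HasGrad.fst z)).sub ((HasGrad.const z (R / 2)).mul
    (HasGrad.comp_left (hasDerivAt_pow 2 z.2) (HasGrad.snd z)))).congr_grad
      (by simp) (by simp; ring)

theorem hasGrad_amp : HasGrad (amp R) z (-(R * z.1) * amp R z) (-(R * z.2) * amp R z) :=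
  (HasGrad.comp_left (Real.hasDerivAt_exp _) (((HasGrad.const z (R / 2)).mul
    ((HasGrad.comp_left (hasDerivAt_pow 2 z.1) (HasGrad.fst z)).add
      (HasGrad.comp_left (hasDerivAt_pow 2 z.2) (HasGrad.snd z)))).neg)).congr_grad
      (by simp [amp]; ring) (by simp [amp]; ring)

theorem hasGrad_waveC : HasGrad (waveC R) z (-(R * z.1) * waveC R z - R ^ 4 * waveS R z)
    (-(R * z.2) * waveC R z + R * z.2 * waveS R z) :=
  ((hasGrad_amp R z).mul (HasGrad.comp_left (Real.hasDerivAt_cos _)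
    (hasGrad_phase R z))).congr_grad (by simp [waveC, waveS]; ring) (by simp [waveC, waveS]; ring)

theorem hasGrad_waveS : HasGrad (waveS R) z (-(R * z.1) * waveS R z + R ^ 4 * waveC R z)
    (-(R * z.2) * waveS R z - R * z.2 * waveC R z) :=
  ((hasGrad_amp R z).mul (HasGrad.comp_left (Real.hasDerivAt_sin _)
    (hasGrad_phase R z))).congr_grad (by simp [waveC, waveS]; ring) (by simp [waveC, waveS]; ring)

theorem continuous_waveC : Continuous (waveC R) :=
  continuous_iff_continuousAt.2 fun z => (hasGrad_waveC R z).continuousAt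

theorem continuous_waveS : Continuous (waveS R) :=
  continuous_iff_continuousAt.2 fun z => (hasGrad_waveS R z).continuousAt

theorem abs_waveC_le : |waveC R z| ≤ amp R z := by
  rw [waveC, abs_mul, abs_of_pos (amp_pos R z)]
  exact mul_le_of_le_one_right (amp_pos R z).le (Real.abs_cos_le_one _)

theorem abs_waveS_le : |waveS R z| ≤ amp R z := by
  rw [waveS, abs_mul, abs_of_pos (amp_pos R z)]
  exact mul_le_of_le_one_right (amp_pos R z).le (Real.abs_sin_le_one _)

end Wave

/-- The coefficient of `v_P` in the linear equation solved by the wave packet. -/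
noncomputable def beta0 (R : ℝ) (z : ℝ × ℝ) : ℝ :=
  R⁻¹ ^ 3 - 2 * R⁻¹ ^ 2 * z.2 ^ 2 - 2 * R⁻¹ ^ 6 * z.1

/-- The coefficient of `v` in the linear equation solved by the wave packet. -/
noncomputable def gamma0 (R : ℝ) (z : ℝ × ℝ) : ℝ :=
  -R⁻¹ ^ 6 + R⁻¹ ^ 5 * z.1 ^ 2 - R⁻¹ ^ 2 * z.1 + 2 * R⁻¹ * (z.2 ^ 2 * z.1)

section Packet

variable (T T1 T2 : ℝ → ℝ) (R : ℝ)

/-- The truncated wave packet. -/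
noncomputable def pk (z : ℝ × ℝ) : ℝ := T z.1 * T z.2 * waveC R z

/-- The derivative of `pk` in the first variable. -/
noncomputable def pkP (z : ℝ × ℝ) : ℝ :=
  T1 z.1 * T z.2 * waveC R z + T z.1 * T z.2 * (-(R * z.1) * waveC R z - R ^ 4 * waveS R z)

/-- The derivative of `pk` in the second variable. -/
noncomputable def pky (z : ℝ × ℝ) : ℝ :=
  T z.1 * T1 z.2 * waveC R z + T z.1 * T z.2 * (-(R * z.2) * waveC R z + R * z.2 * waveS R z)

/-- The second derivative of `pk` in the first variable. -/
noncomputable def pkPP (z : ℝ × ℝ) : ℝ :=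
  T2 z.1 * T z.2 * waveC R z + 2 * (T1 z.1 * T z.2) * (-(R * z.1) * waveC R z - R ^ 4 * waveS R z)
    + T z.1 * T z.2 * ((-R + R ^ 2 * z.1 ^ 2 - R ^ 8) * waveC R z + 2 * R ^ 5 * z.1 * waveS R z)

/-- The mixed second derivative of `pk`. -/
noncomputable def pkPy (z : ℝ × ℝ) : ℝ :=
  T1 z.1 * T1 z.2 * waveC R z
    + T1 z.1 * T z.2 * (-(R * z.2) * waveC R z + R * z.2 * waveS R z)
    + T z.1 * T1 z.2 * (-(R * z.1) * waveC R z - R ^ 4 * waveS R z)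
    + T z.1 * T z.2 * (-(R * z.1) * (-(R * z.2) * waveC R z + R * z.2 * waveS R z)
      - R ^ 4 * (-(R * z.2) * waveS R z - R * z.2 * waveC R z))

/-- The second derivative of `pk` in the second variable. -/
noncomputable def pkyy (z : ℝ × ℝ) : ℝ :=
  T z.1 * T2 z.2 * waveC R z + 2 * (T z.1 * T1 z.2) * (-(R * z.2) * waveC R z + R * z.2 * waveS R z)
    + T z.1 * T z.2 * (-R * waveC R z + R * waveS R z - 2 * R ^ 2 * z.2 ^ 2 * waveS R z)

variable {T T1 T2} {ℓ M : ℝ}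

theorem jet2_pk (hT : Cutoff ℓ M T T1 T2) :
    Jet2 (pk T R) (pkP T T1 R) (pky T T1 R) (pkPP T T1 T2 R) (pkPy T T1 R) (pkyy T T1 T2 R) := by
  have c0 : Continuous T := continuous_iff_continuousAt.2 fun t => (hT.h1 t).continuousAt
  have c1 : Continuous T1 := continuous_iff_continuousAt.2 fun t => (hT.h2 t).continuousAt
  have c2 := hT.c2
  have cC := continuous_waveC R
  have cS := continuous_waveS R
  have g00 : ∀ z : ℝ × ℝ, HasGrad (fun w => T w.1 * T w.2) z (T1 z.1 * T z.2) (T z.1 * T1 z.2) :=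
    fun z => HasGrad.prod_mul (hT.h1 _) (hT.h1 _)
  have g10 : ∀ z : ℝ × ℝ, HasGrad (fun w => T1 w.1 * T w.2) z (T2 z.1 * T z.2) (T1 z.1 * T1 z.2) :=
    fun z => HasGrad.prod_mul (hT.h2 _) (hT.h1 _)
  have g01 : ∀ z : ℝ × ℝ, HasGrad (fun w => T w.1 * T1 w.2) z (T1 z.1 * T1 z.2) (T z.1 * T2 z.2) :=
    fun z => HasGrad.prod_mul (hT.h1 _) (hT.h2 _)
  have gP : ∀ z, HasGrad (fun w => R * w.1) z R 0 := fun z =>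
    ((HasGrad.const z R).mul (HasGrad.fst z)).congr_grad (by simp) (by simp)
  have gy : ∀ z, HasGrad (fun w => R * w.2) z 0 R := fun z =>
    ((HasGrad.const z R).mul (HasGrad.snd z)).congr_grad (by simp) (by simp)
  have hC := hasGrad_waveC R
  have hS := hasGrad_waveS R
  refine ⟨fun z => ?_, fun z => ?_, fun z => ?_, ?_, ?_, ?_⟩
  · exact ((g00 z).mul (hC z)).congr_grad rfl rfl
  · refine (((g10 z).mul (hC z)).add ((g00 z).mul (((gP z).neg.mul (hC z)).sub
      ((HasGrad.const z (R ^ 4)).mul (hS z))))).congr_grad ?_ ?_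
    · unfold pkPP; ring
    · unfold pkPy; ring
  · refine (((g01 z).mul (hC z)).add ((g00 z).mul (((gy z).neg.mul (hC z)).add
      ((gy z).mul (hS z))))).congr_grad ?_ ?_
    · unfold pkPy; ring
    · unfold pkyy; ring
  · unfold pkPP; fun_prop
  · unfold pkPy; fun_prop
  · unfold pkyy; fun_prop

/-- The remainder left when the transposed linear operator is applied to the truncated packet. -/
noncomputable def pkErr (T T1 T2 : ℝ → ℝ) (R : ℝ) (z : ℝ × ℝ) : ℝ :=
  pkyy T T1 T2 R z - R⁻¹ ^ 7 * pkPP T T1 T2 R z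
    + (-2 * R⁻¹ ^ 6 * pk T R z + beta0 R z * pkP T T1 R z) - gamma0 R z * pk T R z

/-- The complex packet has logarithmic derivatives `-R P + i R⁴` and `-(1 + i) R y`. Inserted in the
transposed equation, its imaginary part determines `beta0` and its real part then determines
`gamma0`. Since `(1 + i)² = 2i`, no real term `R² y²` appears, and `R⁻⁷ R⁸ = R` cancels the `-R`
from the second `y`-derivative; hence both coefficients tend to zero on bounded sets as `R` grows.
Only terms with a differentiated cutoff survive. -/
theorem pkErr_eq (hR : R ≠ 0) (z : ℝ × ℝ) : pkErr T T1 T2 R z =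
    T z.1 * (T2 z.2 * waveC R z) + 2 * T z.1 * (-(R * z.2)) * (T1 z.2 * waveC R z)
      + 2 * T z.1 * (R * z.2) * (T1 z.2 * waveS R z)
      - R⁻¹ ^ 7 * T z.2 * (T2 z.1 * waveC R z)
      + 2 * R⁻¹ ^ 7 * T z.2 * (R * z.1) * (T1 z.1 * waveC R z)
      + 2 * R⁻¹ ^ 7 * T z.2 * R ^ 4 * (T1 z.1 * waveS R z)
      + beta0 R z * T z.2 * (T1 z.1 * waveC R z) := by
  unfold pkErr pkyy pkPP pkP pk gamma0 beta0
  field_simp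
  ring

/-- Every surviving term carries `T1` or `T2`, which vanish unless the corresponding coordinate is
at least `ℓ / 8` in size. There the Gaussian is at most `exp (-(R / 2) (ℓ / 8)²)`, while the
coefficients grow no faster than `R⁴`. -/
theorem abs_pkErr_le (hT : Cutoff ℓ M T T1 T2) (hM : 0 ≤ M) (hℓ : 0 < ℓ) (hℓ1 : ℓ ≤ 1)
    (hR : 1 ≤ R) (z : ℝ × ℝ) :
    |pkErr T T1 T2 R z| ≤ 20 * M * R ^ 4 * Real.exp (-(ℓ ^ 2 / 128 * R)) := by
  set A := Real.exp (-(ℓ ^ 2 / 128 * R)) with hA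
  have hA0 : 0 < A := Real.exp_pos _
  have ampx : ℓ / 8 ≤ |z.1| → amp R z ≤ A := by
    intro h
    refine Real.exp_le_exp.2 (neg_le_neg ?_)
    have : (ℓ / 8) ^ 2 ≤ z.1 ^ 2 := sq_le_sq.2 (by rwa [abs_of_pos (by positivity)])
    nlinarith [sq_nonneg z.2]
  have ampy : ℓ / 8 ≤ |z.2| → amp R z ≤ A := by
    intro h
    refine Real.exp_le_exp.2 (neg_le_neg ?_)
    have : (ℓ / 8) ^ 2 ≤ z.2 ^ 2 := sq_le_sq.2 (by rwa [abs_of_pos (by positivity)])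
    nlinarith [sq_nonneg z.1]
  have key : ∀ a b : ℝ, |a| ≤ M → |b| ≤ A → |a * b| ≤ M * A := fun a b ha hb => by
    rw [abs_mul]; exact mul_le_mul ha hb (abs_nonneg _) hM
  have hMA : 0 ≤ M * A := by positivity
  have hy : |T1 z.2 * waveC R z| ≤ M * A ∧ |T1 z.2 * waveS R z| ≤ M * A ∧
      |T2 z.2 * waveC R z| ≤ M * A := by
    rcases le_total (|z.2|) (ℓ / 8) with h | h
    · obtain ⟨-, h1, h2⟩ := hT.one _ h
      simp [h1, h2, hMA]
    · exact ⟨key _ _ (hT.b1 _) ((abs_waveC_le R z).trans (ampy h)),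
        key _ _ (hT.b1 _) ((abs_waveS_le R z).trans (ampy h)),
        key _ _ (hT.b2 _) ((abs_waveC_le R z).trans (ampy h))⟩
  have hx : |T1 z.1 * waveC R z| ≤ M * A ∧ |T1 z.1 * waveS R z| ≤ M * A ∧
      |T2 z.1 * waveC R z| ≤ M * A := by
    rcases le_total (|z.1|) (ℓ / 8) with h | h
    · obtain ⟨-, h1, h2⟩ := hT.one _ h
      simp [h1, h2, hMA]
    · exact ⟨key _ _ (hT.b1 _) ((abs_waveC_le R z).trans (ampx h)),
        key _ _ (hT.b1 _) ((abs_waveS_le R z).trans (ampx h)),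
        key _ _ (hT.b2 _) ((abs_waveC_le R z).trans (ampx h))⟩
  have hR0 : R ≠ 0 := by positivity
  -- Outside the unit box a cutoff factor and its derivatives vanish, because `3ℓ / 8 < 1`.
  by_cases hz : |z.1| ≤ 1 ∧ |z.2| ≤ 1
  · rw [pkErr_eq R hR0]
    have i1 : R⁻¹ ≤ 1 := inv_le_one_of_one_le₀ hR
    have i0 : 0 ≤ R⁻¹ := by positivity
    have ip : ∀ k, |R⁻¹ ^ k| ≤ 1 := fun k => by
      rw [abs_of_nonneg (by positivity)]; exact pow_le_one₀ i0 i1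
    have R4 : 1 ≤ R ^ 4 := one_le_pow₀ hR
    have RR4 : R ≤ R ^ 4 := le_self_pow₀ hR (by norm_num)
    have aT : ∀ t, |T t| ≤ 1 := fun t => by
      rw [abs_of_nonneg (hT.nonneg t)]; exact hT.le_one t
    have Rz1 : |R * z.1| ≤ R ^ 4 := by
      rw [abs_mul, abs_of_pos (by linarith)]
      nlinarith [hz.1, abs_nonneg z.1]
    have Rz2 : |R * z.2| ≤ R ^ 4 := by
      rw [abs_mul, abs_of_pos (by linarith)]
      nlinarith [hz.2, abs_nonneg z.2]
    have hβ : |beta0 R z| ≤ 5 := by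
      unfold beta0
      have e1 := ip 3
      have e2 : |R⁻¹ ^ 2 * z.2 ^ 2| ≤ 1 := by
        rw [abs_mul, abs_pow z.2]
        exact mul_le_one₀ (ip 2) (by positivity)
          (pow_le_one₀ (abs_nonneg _) hz.2)
      have e3 : |R⁻¹ ^ 6 * z.1| ≤ 1 := by
        rw [abs_mul]; exact mul_le_one₀ (ip 6) (by positivity) hz.1
      rw [abs_le] at *
      constructor <;> nlinarith
    have tri : ∀ a b c d e f g B : ℝ, |a| ≤ B → |b| ≤ 2 * B → |c| ≤ 2 * B → |d| ≤ B → |e| ≤ 2 * B →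
        |f| ≤ 2 * B → |g| ≤ 5 * B → |a + b + c - d + e + f + g| ≤ 20 * B := by
      intro a b c d e f g B h1 h2 h3 h4 h5 h6 h7
      rw [abs_le] at *
      constructor <;> linarith
    have e0 : 20 * M * R ^ 4 * A = 20 * (R ^ 4 * (M * A)) := by ring
    rw [e0]
    have one : ∀ k x : ℝ, |k| ≤ R ^ 4 → |x| ≤ M * A → |k * x| ≤ R ^ 4 * (M * A) :=
        fun k x hk hx => by
      rw [abs_mul]; exact mul_le_mul hk hx (abs_nonneg _) (by positivity)
    have two : ∀ j k x : ℝ, 0 ≤ j → |k| ≤ j * R ^ 4 → |x| ≤ M * A →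
        |k * x| ≤ j * (R ^ 4 * (M * A)) := fun j k x hj hk hx => by
      rw [abs_mul, ← mul_assoc]; exact mul_le_mul hk hx (abs_nonneg _) (by positivity)
    have m1 : ∀ a b : ℝ, |a| ≤ 1 → |b| ≤ R ^ 4 → |a * b| ≤ R ^ 4 := fun a b ha hb => by
      rw [abs_mul]; exact (mul_le_of_le_one_left (abs_nonneg _) ha).trans hb
    have m2 : ∀ a b : ℝ, |a| ≤ 1 → |b| ≤ R ^ 4 → |2 * a * b| ≤ 2 * R ^ 4 := fun a b ha hb => by
      rw [mul_assoc, abs_mul, abs_two]; linarith [m1 a b ha hb]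
    have m3 : ∀ a c b : ℝ, |a| ≤ 1 → |c| ≤ 1 → |b| ≤ R ^ 4 → |2 * a * c * b| ≤ 2 * R ^ 4 :=
      fun a c b ha hc hb => by
        rw [mul_assoc 2 a c]
        exact m2 _ _ (by rw [abs_mul]; exact mul_le_one₀ ha (abs_nonneg _) hc) hb
    refine tri _ _ _ _ _ _ _ _ ?_ ?_ ?_ ?_ ?_ ?_ ?_
    · exact one _ _ ((aT _).trans R4) hy.2.2
    · exact two _ _ _ (by norm_num) (m2 _ _ (aT _) (by rwa [abs_neg])) hy.1
    · exact two _ _ _ (by norm_num) (m2 _ _ (aT _) Rz2) hy.2.1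
    · exact one _ _ (m1 _ _ (ip 7) ((aT _).trans R4)) hx.2.2
    · exact two _ _ _ (by norm_num) (m3 _ _ _ (ip 7) (aT _) Rz1) hx.1
    · exact two _ _ _ (by norm_num) (m3 _ _ _ (ip 7) (aT _) (by rw [abs_of_pos (by linarith)]))
        hx.2.1
    · refine two _ _ _ (by norm_num) ?_ hx.1
      rw [abs_mul]
      nlinarith [aT z.2, abs_nonneg (T z.2), abs_nonneg (beta0 R z)]
  · have : pkErr T T1 T2 R z = 0 := by
      rw [pkErr_eq R hR0]
      rcases not_and_or.1 hz with h | h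
      · obtain ⟨h0, h1, h2⟩ := hT.zero z.1 (by linarith [not_le.1 h])
        simp [h0, h1, h2]
      · obtain ⟨h0, h1, h2⟩ := hT.zero z.2 (by linarith [not_le.1 h])
        simp [h0, h1, h2]
    rw [this, abs_zero]
    positivity

theorem pk_mul_cos_nonneg (hT : Cutoff ℓ M T T1 T2) (z : ℝ × ℝ) :
    0 ≤ Real.cos (phase R z) * pk T R z := by
  have : Real.cos (phase R z) * pk T R z
      = T z.1 * T z.2 * amp R z * Real.cos (phase R z) ^ 2 := by unfold pk waveC; ring
  rw [this]
  have := hT.nonneg z.1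
  have := hT.nonneg z.2
  have : 0 < amp R z := amp_pos R z
  positivity

/-- The radius `R⁻⁴ / 4` is the scale of one oscillation: the phase stays within `1 / 2` of zero and
the amplitude stays close to one. -/
theorem le_pk_mul_cos (hT : Cutoff ℓ M T T1 T2) (hR : 1 ≤ R) (hRℓ : R⁻¹ ^ 4 / 4 ≤ ℓ / 8)
    {z : ℝ × ℝ} (h1 : |z.1| ≤ R⁻¹ ^ 4 / 4) (h2 : |z.2| ≤ R⁻¹ ^ 4 / 4) :
    1 / 16 ≤ Real.cos (phase R z) * pk T R z := by
  have : Real.cos (phase R z) * pk T R z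
      = T z.1 * T z.2 * amp R z * Real.cos (phase R z) ^ 2 := by unfold pk waveC; ring
  rw [this, (hT.one _ (h1.trans hRℓ)).1, (hT.one _ (h2.trans hRℓ)).1, one_mul, one_mul]
  have hR0 : R ≠ 0 := by positivity
  have i1 : R⁻¹ ≤ 1 := inv_le_one_of_one_le₀ hR
  have i0 : 0 ≤ R⁻¹ := by positivity
  have sq : ∀ t : ℝ, |t| ≤ R⁻¹ ^ 4 / 4 → R * t ^ 2 ≤ 1 / 16 := by
    intro t ht
    have : t ^ 2 ≤ (R⁻¹ ^ 4 / 4) ^ 2 :=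
      sq_le_sq.2 (by rwa [abs_of_nonneg (by positivity : 0 ≤ R⁻¹ ^ 4 / 4)])
    calc R * t ^ 2 ≤ R * (R⁻¹ ^ 4 / 4) ^ 2 := by gcongr
      _ = R⁻¹ ^ 7 / 16 := by field_simp; norm_num
      _ ≤ 1 / 16 := by
        have := pow_le_one₀ (n := 7) i0 i1
        linarith
  have s1 := sq _ h1
  have s2 := sq _ h2
  have n2 : 0 ≤ R * z.2 ^ 2 := by positivity
  have hamp : 15 / 16 ≤ amp R z := by
    have := Real.add_one_le_exp (-(R / 2 * (z.1 ^ 2 + z.2 ^ 2)))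
    unfold amp
    nlinarith
  have hph : |phase R z| ≤ 1 / 2 := by
    have a1 : |R ^ 4 * z.1| ≤ 1 / 4 := by
      rw [abs_mul, abs_of_pos (by positivity)]
      calc R ^ 4 * |z.1| ≤ R ^ 4 * (R⁻¹ ^ 4 / 4) := by gcongr
        _ = 1 / 4 := by field_simp
    unfold phase
    rw [abs_le] at *
    constructor <;> nlinarith
  have hcos : 7 / 8 ≤ Real.cos (phase R z) := by
    have := Real.one_sub_sq_div_two_le_cos (x := phase R z)
    have h4 : phase R z ^ 2 ≤ (1 / 2) ^ 2 :=
      sq_le_sq.2 (by rwa [abs_of_pos (by norm_num : (0 : ℝ) < 1 / 2)])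
    linarith
  have : (7 / 8 : ℝ) ^ 2 ≤ Real.cos (phase R z) ^ 2 := by gcongr
  calc (1 / 16 : ℝ) ≤ 15 / 16 * (7 / 8) ^ 2 := by norm_num
    _ ≤ _ := by gcongr

end Packet

/-! ### Testing a solution against the packet -/

namespace Jet3

variable {U : Set (ℝ × ℝ)} {u p q E F G Ex Ey Fy Gy : ℝ × ℝ → ℝ}

/-- Integration of the wave packet along a horizontal segment, by substitution. -/
theorem integral_packet_ge (J : Jet3 U u p q E F G Ex Ey Fy Gy) {g : ℝ × ℝ → ℝ}
    (cg : Continuous g) (g0 : ∀ z, 0 ≤ g z) {a₁ b₁ y lo hi P₀ d k s : ℝ} (h₁ : a₁ ≤ b₁)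
    (hU : ∀ x ∈ Icc a₁ b₁, (x, y) ∈ U) (hlo : lo ≤ P₀ - d) (hhi : P₀ + d ≤ hi) (hd : 0 ≤ d)
    (hs : (s = 1 ∧ p (a₁, y) ≤ lo ∧ hi ≤ p (b₁, y)) ∨
      (s = -1 ∧ p (b₁, y) ≤ lo ∧ hi ≤ p (a₁, y)))
    (hk : ∀ P, |P - P₀| ≤ d → k ≤ g (P, y)) :
    2 * d * k ≤ s * ∫ x in a₁..b₁, E (x, y) * g (p (x, y), y) := by
  obtain ⟨cu, cp, cq, cE, cF, cG⟩ := J.continuousOn_all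
  have cgy : Continuous fun P => g (P, y) := cg.comp (by fun_prop)
  -- The substitution `P = p (x, y)` needs no monotonicity: only the endpoint values of `p` enter.
  have sub : ∫ x in a₁..b₁, E (x, y) * g (p (x, y), y)
      = ∫ P in p (a₁, y)..p (b₁, y), g (P, y) := by
    rw [← intervalIntegral.integral_comp_mul_deriv (f := fun x => p (x, y))
      (f' := fun x => E (x, y))
      (g := fun P => g (P, y)) _ _ cgy]
    · simp [mul_comm]
    · intro x hx
      rw [uIcc_of_le h₁] at hx
      exact (J.hp _ (hU x hx)).hasDerivAt_fst
    · rw [uIcc_of_le h₁]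
      exact cE.comp (by fun_prop) hU
  have main : ∀ A B, A ≤ lo → hi ≤ B → 2 * d * k ≤ ∫ P in A..B, g (P, y) := by
    intro A B hA hB
    calc 2 * d * k = ∫ _ in (P₀ - d)..(P₀ + d), k := by
          rw [intervalIntegral.integral_const, smul_eq_mul]; ring
      _ ≤ ∫ P in (P₀ - d)..(P₀ + d), g (P, y) := by
        refine intervalIntegral.integral_mono_on (by linarith) (by simp)
          (cgy.intervalIntegrable _ _) fun P hP => hk P ?_
        rw [abs_le]
        constructor <;> linarith [hP.1, hP.2]
      _ ≤ ∫ P in A..B, g (P, y) :=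
        intervalIntegral.integral_mono_interval (by linarith) (by linarith) (by linarith)
          (Filter.Eventually.of_forall fun P => g0 _) (cgy.intervalIntegrable _ _)
  rw [sub]
  rcases hs with ⟨rfl, h1, h2⟩ | ⟨rfl, h1, h2⟩
  · rw [one_mul]; exact main _ _ h1 h2
  · rw [intervalIntegral.integral_symm, neg_one_mul, neg_neg]; exact main _ _ h1 h2

/-- A solution with `u_xx ≠ 0` on a box violates the size of the resonant source, when tested
against the wave packet. -/
theorem source_le (J : Jet3 U u p q E F G Ex Ey Fy Gy) {T T1 T2 : ℝ → ℝ} {ℓ M R : ℝ}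
    (hT : Cutoff ℓ M T T1 T2) (hM : 0 ≤ M) (hℓ : 0 < ℓ) (hℓ1 : ℓ ≤ 1) (hR : 1 ≤ R)
    (hRℓ : R⁻¹ ^ 4 / 4 ≤ ℓ / 8) {a₁ b₁ y₀ P₀ N ε s : ℝ} {c : ℝ × ℝ → ℝ} (h₁ : a₁ ≤ b₁)
    (w₁ : b₁ - a₁ ≤ 1) (hε : 0 ≤ ε)
    (hU : Icc a₁ b₁ ×ˢ Icc (y₀ - ℓ / 2) (y₀ + ℓ / 2) ⊆ U)
    (hs : ∀ y ∈ Icc (y₀ - ℓ / 2) (y₀ + ℓ / 2),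
      (s = 1 ∧ p (a₁, y) ≤ P₀ - ℓ / 2 ∧ P₀ + ℓ / 2 ≤ p (b₁, y)) ∨
      (s = -1 ∧ p (b₁, y) ≤ P₀ - ℓ / 2 ∧ P₀ + ℓ / 2 ≤ p (a₁, y)))
    (hE : ∀ z ∈ Icc a₁ b₁ ×ˢ Icc (y₀ - ℓ / 2) (y₀ + ℓ / 2), |E z| ≤ N)
    (hv : ∀ z ∈ Icc a₁ b₁ ×ˢ Icc (y₀ - ℓ / 2) (y₀ + ℓ / 2), |z.1 * p z - u z| ≤ N)
    (hc : ∀ z ∈ Icc a₁ b₁ ×ˢ Icc (y₀ - ℓ / 2) (y₀ + ℓ / 2), |p z - P₀| ≤ ℓ / 2 →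
      c z = ε * Real.cos (phase R (p z - P₀, z.2 - y₀)) + beta0 R (p z - P₀, z.2 - y₀) * z.1
        + gamma0 R (p z - P₀, z.2 - y₀) * (z.1 * p z - u z))
    (heq : ∀ z ∈ Icc a₁ b₁ ×ˢ Icc (y₀ - ℓ / 2) (y₀ + ℓ / 2),
      E z * (G z + c z) - F z ^ 2 = -R⁻¹ ^ 7) :
    ε * R⁻¹ ^ 8 / 64 ≤ N * N * (20 * M * R ^ 4 * Real.exp (-(ℓ ^ 2 / 128 * R))) := by
  obtain ⟨cu, cp, cq, cE, cF, cG⟩ := J.continuousOn_all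
  set a₂ := y₀ - ℓ / 2 with ha₂
  set b₂ := y₀ + ℓ / 2 with hb₂
  have h₂ : a₂ ≤ b₂ := by linarith
  set K := Icc a₁ b₁ ×ˢ Icc a₂ b₂ with hK
  have hKc : IsCompact K := isCompact_Icc.prod isCompact_Icc
  have hvol : volume.real K ≤ 1 := by
    rw [hK, Measure.volume_eq_prod, measureReal_prod_prod, Real.volume_real_Icc_of_le h₁,
      Real.volume_real_Icc_of_le h₂]
    exact mul_le_one₀ w₁ (by linarith) (by linarith)
  have hN : 0 ≤ N := (abs_nonneg _).trans (hE (a₁, a₂) ⟨⟨le_rfl, h₁⟩, ⟨le_rfl, h₂⟩⟩)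
  set C : ℝ × ℝ := (P₀, y₀) with hC
  have TJ := (jet2_pk R hT).translate C
  have gβ : ∀ z, HasGrad (beta0 R) z (-2 * R⁻¹ ^ 6) (-4 * R⁻¹ ^ 2 * z.2) := fun z =>
    (((HasGrad.const z (R⁻¹ ^ 3)).sub ((HasGrad.const z (2 * R⁻¹ ^ 2)).mul
      (HasGrad.comp_left (hasDerivAt_pow 2 z.2) (HasGrad.snd z)))).sub
      ((HasGrad.const z (2 * R⁻¹ ^ 6)).mul (HasGrad.fst z))).congr_grad
      (by simp) (by simp; ring)
  have cβ : Continuous (beta0 R) := continuous_iff_continuousAt.2 fun z => (gβ z).continuousAt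
  have gw : ∀ z, HasGrad (fun z => beta0 R (z - C) * pk T R (z - C)) z _ _ := fun z =>
    ((gβ _).translate).mul (TJ.h0 z)
  have cpk : Continuous (pk T R) :=
    continuous_iff_continuousAt.2 fun z => ((jet2_pk R hT).h0 z).continuousAt
  have cpkP : Continuous (pkP T T1 R) :=
    continuous_iff_continuousAt.2 fun z => ((jet2_pk R hT).hP z).continuousAt
  have pk0 : ∀ z : ℝ × ℝ, 3 * ℓ / 8 ≤ |z.1| ∨ 3 * ℓ / 8 ≤ |z.2| →
      pk T R z = 0 ∧ pkP T T1 R z = 0 ∧ pky T T1 R z = 0 := by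
    rintro z (h | h)
    · obtain ⟨t0, t1, t2⟩ := hT.zero _ h
      simp [pk, pkP, pky, t0, t1]
    · obtain ⟨t0, t1, t2⟩ := hT.zero _ h
      simp [pk, pkP, pky, t0, t1]
  -- The choice `w = β θ` makes `w_P` the first-order part of the transposed operator.
  have key := J.integral_legendre (κ := R⁻¹ ^ 7) TJ gw (by fun_prop) h₁ h₂ hU ?_
  · let g : ℝ × ℝ → ℝ := fun z => ε * (Real.cos (phase R (z - C)) * pk T R (z - C))
    have cph : Continuous (phase R) := by unfold phase; fun_prop
    have cg : Continuous g := by fun_prop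
    have g0 : ∀ z, 0 ≤ g z := fun z => mul_nonneg hε (pk_mul_cos_nonneg R hT _)
    have cγ : Continuous (gamma0 R) := by unfold gamma0; fun_prop
    have cerr : Continuous (pkErr T T1 T2 R) := by
      have c1 := (jet2_pk R hT).cPP
      have c2 := (jet2_pk R hT).cyy
      unfold pkErr
      fun_prop
    have comp : ∀ f : ℝ × ℝ → ℝ, Continuous f → ContinuousOn (fun z => f (p z, z.2)) K :=
      fun f hf => hf.comp_continuousOn ((cp.mono hU).prodMk continuousOn_snd)
    have cEg : ContinuousOn (fun z => E z * g (p z, z.2)) K := (cE.mono hU).mul (comp g cg)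
    have cEe : ContinuousOn
        (fun z => (z.1 * p z - u z) * E z * pkErr T T1 T2 R ((p z, z.2) - C)) K := by
      have := comp (fun z => pkErr T T1 T2 R (z - C)) (by fun_prop)
      have := cE.mono hU
      have := cp.mono hU
      have := cu.mono hU
      fun_prop
    -- For `|p - P₀| ≤ ℓ / 2` the equation replaces `E G - F² + κ` by `-E c`; the `β x` part of `c`
    -- cancels against `x E w`, the `γ` part joins the transposed operator, and only source and
    -- error remain. For other values of `p` the cutoff annihilates both.
    have split : ∫ z in K, E z * g (p z, z.2)
        = ∫ z in K, (z.1 * p z - u z) * E z * pkErr T T1 T2 R ((p z, z.2) - C) := by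
      rw [← sub_eq_zero, ← integral_sub (cEg.integrableOn_compact hKc)
        (cEe.integrableOn_compact hKc), ← neg_eq_zero, ← integral_neg, ← key]
      refine setIntegral_congr_fun hKc.measurableSet fun z hz => ?_
      have hz2 := heq z hz
      by_cases hp : |p z - P₀| ≤ ℓ / 2
      · have hz1 := hc z hz hp
        have e1 : E z * G z - F z ^ 2 + R⁻¹ ^ 7 = - (E z * c z) := by linarith
        simp only [g, pkErr, e1, hz1, hC, Prod.mk_sub_mk]
        ring
      · have e0 := pk0 ((p z, z.2) - C) (Or.inl (by simp [hC]; linarith [not_le.1 hp]))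
        have e1 := pkErr_eq (T := T) (T1 := T1) (T2 := T2) R (by positivity) ((p z, z.2) - C)
        have e2 := hT.zero ((p z, z.2) - C).1 (by simp [hC]; linarith [not_le.1 hp])
        have e3 : pkErr T T1 T2 R ((p z, z.2) - C) = 0 := by
          rw [e1, e2.1, e2.2.1, e2.2.2]; ring
        have e4 := e3
        rw [pkErr, e0.1] at e4
        simp only [g, e3, e0.1]
        linear_combination (-(z.1 * p z - u z) * E z) * e4
    have up : |∫ z in K, (z.1 * p z - u z) * E z * pkErr T T1 T2 R ((p z, z.2) - C)|
        ≤ N * N * (20 * M * R ^ 4 * Real.exp (-(ℓ ^ 2 / 128 * R))) := by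
      have hB : 0 ≤ N * N * (20 * M * R ^ 4 * Real.exp (-(ℓ ^ 2 / 128 * R))) := by positivity
      rw [← Real.norm_eq_abs]
      refine (norm_setIntegral_le_of_norm_le_const (C := N * N * (20 * M * R ^ 4 *
        Real.exp (-(ℓ ^ 2 / 128 * R)))) hKc.measure_lt_top fun z hz => ?_).trans
        (mul_le_of_le_one_right hB hvol)
      rw [Real.norm_eq_abs, abs_mul, abs_mul]
      exact mul_le_mul (mul_le_mul (hv z hz) (hE z hz) (abs_nonneg _) hN)
        (abs_pkErr_le R hT hM hℓ hℓ1 hR _) (abs_nonneg _) (by positivity)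
    obtain ⟨hi, hfub⟩ := integral_rect_eq h₁ cEg
    set d := R⁻¹ ^ 4 / 4 with hd
    have hd0 : 0 ≤ d := by positivity
    -- Radius and lower bound zero give mere nonnegativity, which permits discarding the values of
    -- `y` far from `y₀`.
    have low : ∀ y ∈ Icc a₂ b₂, 0 ≤ s * ∫ x in a₁..b₁, E (x, y) * g (p (x, y), y) := by
      intro y hy
      have := J.integral_packet_ge cg g0 (P₀ := P₀) (d := 0) (k := 0) h₁ (fun x hx => hU ⟨hx, hy⟩)
        (by linarith) (by linarith) le_rfl (hs y hy) (fun P _ => g0 _)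
      simpa using this
    have low2 : ∀ y ∈ Icc (y₀ - d) (y₀ + d),
        2 * d * (ε / 16) ≤ s * ∫ x in a₁..b₁, E (x, y) * g (p (x, y), y) := by
      intro y hy
      have hy' : y ∈ Icc a₂ b₂ := ⟨by linarith [hy.1], by linarith [hy.2]⟩
      refine J.integral_packet_ge cg g0 (P₀ := P₀) (d := d) h₁ (fun x hx => hU ⟨hx, hy'⟩)
        (by linarith) (by linarith) hd0 (hs y hy') (fun P hP => ?_)
      have := le_pk_mul_cos R hT hR hRℓ (z := (P, y) - C)
        (by simp only [hC, Prod.fst_sub]; exact hP)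
        (by simp only [hC, Prod.snd_sub]; rw [abs_le]; constructor <;> linarith [hy.1, hy.2])
      calc ε / 16 = ε * (1 / 16) := by ring
        _ ≤ _ := mul_le_mul_of_nonneg_left this hε
    have his := hi.const_mul s
    have sub : Icc (y₀ - d) (y₀ + d) ⊆ Icc a₂ b₂ := Icc_subset_Icc (by linarith) (by linarith)
    -- Only the square of half side `d` in `(P, y)` about the packet centre is kept, where the
    -- integrand is at least `ε / 16`.
    have fin : 2 * d * (2 * d * (ε / 16)) ≤ s * ∫ z in K, E z * g (p z, z.2) := by
      rw [hfub, ← integral_const_mul]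
      calc 2 * d * (2 * d * (ε / 16)) = ∫ _ in Icc (y₀ - d) (y₀ + d), 2 * d * (ε / 16) := by
            rw [setIntegral_const, Real.volume_real_Icc_of_le (by linarith), smul_eq_mul]
            ring
        _ ≤ ∫ y in Icc (y₀ - d) (y₀ + d), s * ∫ x in a₁..b₁, E (x, y) * g (p (x, y), y) :=
            setIntegral_mono_on (continuousOn_const.integrableOn_compact isCompact_Icc)
              (IntegrableOn.mono_set his sub) measurableSet_Icc low2
        _ ≤ _ := setIntegral_mono_set his
            ((ae_restrict_iff' measurableSet_Icc).2 (Filter.Eventually.of_forall low))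
            (Filter.Eventually.of_forall sub)
    have hsabs : |s| = 1 := by
      rcases hs a₂ ⟨le_rfl, h₂⟩ with ⟨rfl, -⟩ | ⟨rfl, -⟩ <;> simp
    have fin2 := fin.trans (le_abs_self _)
    rw [abs_mul, hsabs, one_mul, split] at fin2
    have e : ε * R⁻¹ ^ 8 / 64 = 2 * d * (2 * d * (ε / 16)) := by rw [hd]; ring
    rw [e]
    exact fin2.trans up
  · intro z hz hb
    have : 3 * ℓ / 8 ≤ |((p z, z.2) - C).1| ∨ 3 * ℓ / 8 ≤ |((p z, z.2) - C).2| := by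
      simp only [hC, Prod.mk_sub_mk]
      rcases hb with hb | hb | hb | hb
      · left
        have hz' : z = (a₁, z.2) := Prod.ext hb rfl
        rw [hz']
        rcases hs z.2 hz.2 with ⟨-, h1, h2⟩ | ⟨-, h1, h2⟩
        · exact le_trans (by linarith) (neg_le_abs _)
        · exact le_trans (by linarith) (le_abs_self _)
      · left
        have hz' : z = (b₁, z.2) := Prod.ext hb rfl
        rw [hz']
        rcases hs z.2 hz.2 with ⟨-, h1, h2⟩ | ⟨-, h1, h2⟩
        · exact le_trans (by linarith) (le_abs_self _)
        · exact le_trans (by linarith) (neg_le_abs _)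
      · right
        exact le_trans (by linarith) (neg_le_abs _)
      · right
        exact le_trans (by linarith) (le_abs_self _)
    obtain ⟨e0, e1, e2⟩ := pk0 _ this
    exact ⟨e0, e1, e2, by rw [e0, mul_zero]⟩

end Jet3

/-! ### Periodised coefficients and smallness of `u_xx` -/

/-- `σ` is the identity modulo `2π` near the lattice `2πℤ`. -/
def IsSawtooth (σ : ℝ → ℝ) : Prop :=
  ∀ (k : ℤ) (t : ℝ), |t| ≤ 1 / 2 → σ (k * (2 * Real.pi) + t) = t

theorem IsSawtooth.scaled {σ : ℝ → ℝ} (hσ : IsSawtooth σ) {ℓ : ℝ} (hℓ : 0 < ℓ) (k : ℤ) {t : ℝ}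
    (ht : |t - k * (2 * Real.pi * ℓ)| ≤ ℓ / 2) :
    ℓ * σ (t / ℓ) = t - k * (2 * Real.pi * ℓ) := by
  have h : t / ℓ = k * (2 * Real.pi) + (t - k * (2 * Real.pi * ℓ)) / ℓ := by
    field_simp; ring
  rw [h, hσ]
  · field_simp
  · rw [abs_div, abs_of_pos hℓ, div_le_iff₀ hℓ]
    linarith

/-- Half a period is `πℓ < 4ℓ`. Hence a packet centre is close to any given value of `u_x` or `y`.
-/
theorem exists_lattice_near {ℓ : ℝ} (hℓ : 0 < ℓ) (t : ℝ) :
    ∃ k : ℤ, |t - k * (2 * Real.pi * ℓ)| ≤ 4 * ℓ := by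
  refine ⟨round (t / (2 * Real.pi * ℓ)), ?_⟩
  have hL : 0 < 2 * Real.pi * ℓ := by positivity
  have h := abs_sub_round (t / (2 * Real.pi * ℓ))
  have e : t - round (t / (2 * Real.pi * ℓ)) * (2 * Real.pi * ℓ)
      = (t / (2 * Real.pi * ℓ) - round (t / (2 * Real.pi * ℓ))) * (2 * Real.pi * ℓ) := by
    field_simp
  rw [e, abs_mul, abs_of_pos hL]
  have := Real.pi_lt_four
  nlinarith

theorem abs_sub_le_of_hasGrad {f fx fy : ℝ × ℝ → ℝ} {K : Set (ℝ × ℝ)} {A r : ℝ} (hK : Convex ℝ K)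
    (h : ∀ z ∈ K, HasGrad f z (fx z) (fy z)) (hA : ∀ z ∈ K, |fx z| ≤ A ∧ |fy z| ≤ A) (hA0 : 0 ≤ A)
    {z w : ℝ × ℝ} (hz : z ∈ K) (hw : w ∈ K) (h1 : |z.1 - w.1| ≤ r) (h2 : |z.2 - w.2| ≤ r) :
    |f z - f w| ≤ 2 * A * r := by
  have key := hK.norm_image_sub_le_of_norm_hasFDerivWithin_le (C := 2 * A)
    (fun z hz => (h z hz).hasFDerivWithinAt) (fun z hz => ?_) hw hz
  · rw [Real.norm_eq_abs] at key
    refine key.trans (mul_le_mul_of_nonneg_left ?_ (by positivity))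
    exact max_le h1 h2
  · refine (norm_add_le _ _).trans ?_
    rw [norm_smul, norm_smul]
    have := mul_le_mul (hA z hz).1 (ContinuousLinearMap.norm_fst_le ℝ ℝ ℝ) (norm_nonneg _) hA0
    have := mul_le_mul (hA z hz).2 (ContinuousLinearMap.norm_snd_le ℝ ℝ ℝ) (norm_nonneg _) hA0
    simp only [Real.norm_eq_abs] at *
    linarith

/-- The zeroth-order coefficient built from the periodised wave packet. -/
noncomputable def packetCoeff (σ : ℝ → ℝ) (ℓ R ε x y u p : ℝ) : ℝ :=
  ε * Real.cos (phase R (ℓ * σ (p / ℓ), ℓ * σ (y / ℓ)))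
    + beta0 R (ℓ * σ (p / ℓ), ℓ * σ (y / ℓ)) * x
    + gamma0 R (ℓ * σ (p / ℓ), ℓ * σ (y / ℓ)) * (x * p - u)

namespace Jet3

variable {U : Set (ℝ × ℝ)} {u p q E F G Ex Ey Fy Gy : ℝ × ℝ → ℝ}

/-- A bounded solution has small `u_xx` at the centre of a box on which the coefficients are those
of the wave packet. -/
theorem abs_uxx_lt (J : Jet3 U u p q E F G Ex Ey Fy Gy) {T T1 T2 σ : ℝ → ℝ} {ℓ M R : ℝ}
    (hT : Cutoff ℓ M T T1 T2) (hσ : IsSawtooth σ) (hM : 0 ≤ M) (hℓ : 0 < ℓ) (hℓ1 : ℓ ≤ 1)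
    (hR : 1 ≤ R) (hRℓ : R⁻¹ ^ 4 / 4 ≤ ℓ / 8) {x₀ y₀ N ε e r : ℝ} {c : ℝ × ℝ → ℝ}
    (hε : 0 ≤ ε) (hN : 1 ≤ N) (hr : 0 < r) (hr1 : r ≤ 1 / 2) (hre : 4 * N * r ≤ e)
    (hℓr : 5 * ℓ ≤ r) (hℓe : 20 * N * ℓ ≤ e * r)
    (hU : Icc (x₀ - r) (x₀ + r) ×ˢ Icc (y₀ - r) (y₀ + r) ⊆ U)
    (hx : ∀ z ∈ Icc (x₀ - r) (x₀ + r) ×ˢ Icc (y₀ - r) (y₀ + r), |z.1| ≤ 2)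
    (hb : ∀ z ∈ Icc (x₀ - r) (x₀ + r) ×ˢ Icc (y₀ - r) (y₀ + r), |u z| ≤ N ∧ |p z| ≤ N ∧
      |E z| ≤ N ∧ |F z| ≤ N ∧ |Ex z| ≤ N ∧ |Ey z| ≤ N)
    (hc : ∀ z ∈ Icc (x₀ - r) (x₀ + r) ×ˢ Icc (y₀ - r) (y₀ + r),
      c z = packetCoeff σ ℓ R ε z.1 z.2 (u z) (p z))
    (heq : ∀ z ∈ Icc (x₀ - r) (x₀ + r) ×ˢ Icc (y₀ - r) (y₀ + r),
      E z * (G z + c z) - F z ^ 2 = -R⁻¹ ^ 7)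
    (hlarge : 3 * N * (3 * N) * (20 * M * R ^ 4 * Real.exp (-(ℓ ^ 2 / 128 * R)))
      < ε * R⁻¹ ^ 8 / 64) :
    |E (x₀, y₀)| < e := by
  by_contra! hcon
  set K := Icc (x₀ - r) (x₀ + r) ×ˢ Icc (y₀ - r) (y₀ + r) with hK
  have hKconv : Convex ℝ K := (convex_Icc _ _).prod (convex_Icc _ _)
  have hz₀ : (x₀, y₀) ∈ K := ⟨⟨by simp only; linarith, by simp only; linarith⟩,
    ⟨by simp only; linarith, by simp only; linarith⟩⟩
  obtain ⟨j, hj⟩ := exists_lattice_near hℓ y₀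
  obtain ⟨k, hk⟩ := exists_lattice_near hℓ (p (x₀, y₀))
  set y₁ := (j : ℝ) * (2 * Real.pi * ℓ) with hy₁
  set P₀ := (k : ℝ) * (2 * Real.pi * ℓ) with hP₀
  have hsub : Icc (y₁ - ℓ / 2) (y₁ + ℓ / 2) ⊆ Icc (y₀ - r) (y₀ + r) := by
    rw [abs_le] at hj
    exact Icc_subset_Icc (by linarith [hj.1, hj.2]) (by linarith [hj.1, hj.2])
  have hsubK : Icc (x₀ - r) (x₀ + r) ×ˢ Icc (y₁ - ℓ / 2) (y₁ + ℓ / 2) ⊆ K :=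
    prod_mono le_rfl hsub
  -- The third-derivative bound enters here: `E` varies by at most `2 N r ≤ e / 2`, so it keeps its
  -- sign and stays at least `e / 2` in size.
  have hEvar : ∀ z ∈ K, |E z - E (x₀, y₀)| ≤ e / 2 := by
    intro z hz
    refine (abs_sub_le_of_hasGrad (A := N) (r := r) hKconv (fun z hz => J.hE z (hU hz))
      (fun z hz => (hb z hz).2.2.2.2) (by linarith) hz hz₀ ?_ ?_).trans (by linarith)
    · rw [abs_le]; constructor <;> linarith [hz.1.1, hz.1.2]
    · rw [abs_le]; constructor <;> linarith [hz.2.1, hz.2.2]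
  have hpy : ∀ y ∈ Icc (y₁ - ℓ / 2) (y₁ + ℓ / 2), |p (x₀, y) - p (x₀, y₀)| ≤ 5 * N * ℓ := by
    intro y hy
    have hconv : Convex ℝ (Icc (y₀ - r) (y₀ + r)) := convex_Icc _ _
    have := hconv.norm_image_sub_le_of_norm_hasDerivWithin_le (C := N) (f := fun y => p (x₀, y))
      (f' := fun y => F (x₀, y)) (x := y₀) (y := y)
      (fun y hy => (J.hp (x₀, y) (hU ⟨hz₀.1, hy⟩)).hasDerivAt_snd.hasDerivWithinAt)
      (fun y hy => (hb (x₀, y) ⟨hz₀.1, hy⟩).2.2.2.1) hz₀.2 (hsub hy)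
    rw [Real.norm_eq_abs, Real.norm_eq_abs] at this
    have h5 : |y - y₀| ≤ 5 * ℓ := by
      rw [abs_le] at hj ⊢
      constructor <;> linarith [hj.1, hj.2, hy.1, hy.2]
    calc _ ≤ N * |y - y₀| := this
      _ ≤ N * (5 * ℓ) := by gcongr
      _ = 5 * N * ℓ := by ring
  have slope : ∀ a b y, a < b → x₀ - r ≤ a → b ≤ x₀ + r → y ∈ Icc (y₁ - ℓ / 2) (y₁ + ℓ / 2) →
      ∃ c, (c, y) ∈ K ∧ p (b, y) - p (a, y) = E (c, y) * (b - a) := by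
    intro a b y hab ha hb' hy
    have hin : ∀ x ∈ Icc a b, (x, y) ∈ K := fun x hx =>
      ⟨⟨ha.trans hx.1, hx.2.trans hb'⟩, hsub hy⟩
    obtain ⟨c, hc, hc'⟩ := exists_hasDerivAt_eq_slope (fun x => p (x, y)) (fun x => E (x, y)) hab
      (fun x hx => (J.hp _ (hU (hin x hx))).hasDerivAt_fst.continuousAt.continuousWithinAt)
      (fun x hx => (J.hp _ (hU (hin x (Ioo_subset_Icc_self hx)))).hasDerivAt_fst)
    refine ⟨c, hin c (Ioo_subset_Icc_self hc), ?_⟩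
    rw [hc']
    have : b - a ≠ 0 := by linarith
    field_simp
  have hNℓ : ℓ ≤ N * ℓ := by nlinarith
  -- Each half of the segment moves `p` by at least `e r / 2 ≥ 10 N ℓ`, while `p (x₀, y)` is within
  -- `5 N ℓ + 4 ℓ` of `P₀`. Thus `p` sweeps across the whole interval of half length `ℓ / 2` about
  -- `P₀`, in the direction `s` given by the sign of `E`.
  obtain ⟨s, hs⟩ : ∃ s : ℝ, ∀ y ∈ Icc (y₁ - ℓ / 2) (y₁ + ℓ / 2),
      (s = 1 ∧ p (x₀ - r, y) ≤ P₀ - ℓ / 2 ∧ P₀ + ℓ / 2 ≤ p (x₀ + r, y)) ∨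
      (s = -1 ∧ p (x₀ + r, y) ≤ P₀ - ℓ / 2 ∧ P₀ + ℓ / 2 ≤ p (x₀ - r, y)) := by
    rcases le_abs.1 hcon with h | h
    · refine ⟨1, fun y hy => Or.inl ⟨rfl, ?_⟩⟩
      obtain ⟨c, hc, hc'⟩ := slope (x₀ - r) x₀ y (by linarith) le_rfl (by linarith) hy
      obtain ⟨d, hd, hd'⟩ := slope x₀ (x₀ + r) y (by linarith) (by linarith) le_rfl hy
      have h1 := (abs_le.1 (hEvar _ hc)).1
      have h2 := (abs_le.1 (hEvar _ hd)).1
      have h3 : e / 2 * r ≤ E (c, y) * (x₀ - (x₀ - r)) := by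
        rw [sub_sub_cancel]; exact mul_le_mul_of_nonneg_right (by linarith) hr.le
      have h4 : e / 2 * r ≤ E (d, y) * (x₀ + r - x₀) := by
        rw [add_sub_cancel_left]; exact mul_le_mul_of_nonneg_right (by linarith) hr.le
      have h5 := abs_le.1 (hpy y hy)
      have h6 := abs_le.1 hk
      constructor <;> linarith [h5.1, h5.2, h6.1, h6.2]
    · refine ⟨-1, fun y hy => Or.inr ⟨rfl, ?_⟩⟩
      obtain ⟨c, hc, hc'⟩ := slope (x₀ - r) x₀ y (by linarith) le_rfl (by linarith) hy
      obtain ⟨d, hd, hd'⟩ := slope x₀ (x₀ + r) y (by linarith) (by linarith) le_rfl hy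
      have h1 := (abs_le.1 (hEvar _ hc)).2
      have h2 := (abs_le.1 (hEvar _ hd)).2
      have h3 : E (c, y) * (x₀ - (x₀ - r)) ≤ -(e / 2 * r) := by
        rw [sub_sub_cancel, ← neg_mul]; exact mul_le_mul_of_nonneg_right (by linarith) hr.le
      have h4 : E (d, y) * (x₀ + r - x₀) ≤ -(e / 2 * r) := by
        rw [add_sub_cancel_left, ← neg_mul]; exact mul_le_mul_of_nonneg_right (by linarith) hr.le
      have h5 := abs_le.1 (hpy y hy)
      have h6 := abs_le.1 hk
      constructor <;> linarith [h5.1, h5.2, h6.1, h6.2]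
  refine absurd hlarge (not_lt.2 ?_)
  refine J.source_le (P₀ := P₀) hT hM hℓ hℓ1 hR hRℓ (by linarith) (by linarith) hε
    (hsubK.trans hU) hs
    (fun z hz => (hb z (hsubK hz)).2.2.1.trans (by linarith)) (fun z hz => ?_) (fun z hz hp => ?_)
    (fun z hz => heq z (hsubK hz))
  · obtain ⟨h1, h2, -⟩ := hb z (hsubK hz)
    calc |z.1 * p z - u z| ≤ |z.1 * p z| + |u z| := abs_sub _ _
      _ ≤ 2 * N + N := by
        rw [abs_mul]
        exact add_le_add (mul_le_mul (hx z (hsubK hz)) h2 (abs_nonneg _) (by norm_num)) h1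
      _ = 3 * N := by ring
  · have hy : |z.2 - y₁| ≤ ℓ / 2 := by
      rw [abs_le]; constructor <;> linarith [hz.2.1, hz.2.2]
    rw [hc z (hsubK hz), packetCoeff, hσ.scaled hℓ k hp, hσ.scaled hℓ j hy]

end Jet3

/-! ### Contradiction on one square -/

/-- The closed square with centre `(X, 0)` and half side `ρ`. -/
def square (X ρ : ℝ) : Set (ℝ × ℝ) := Icc (X - ρ) (X + ρ) ×ˢ Icc (-ρ) ρ

theorem mem_square {X ρ : ℝ} {z : ℝ × ℝ} : z ∈ square X ρ ↔ |z.1 - X| ≤ ρ ∧ |z.2| ≤ ρ := by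
  simp only [square, mem_prod, mem_Icc, abs_le]
  constructor <;> rintro ⟨⟨h1, h2⟩, h3, h4⟩ <;> refine ⟨⟨?_, ?_⟩, ?_, ?_⟩ <;> linarith

/-- The boundary of the square of half side `ρ / 2` lies in the ring between `ρ / 4` and `3ρ / 4`,
where the packet argument makes `u_xx` small; `Jet3.integral_sq_le` then contradicts the size of `∫
b²`. Inside the ring `f` is only bounded below, which leaves room for both types. -/
theorem Jet3.false_of_solution {U : Set (ℝ × ℝ)} {u p q E F G Ex Ey Fy Gy : ℝ × ℝ → ℝ}
    (J : Jet3 U u p q E F G Ex Ey Fy Gy) {T T1 T2 σ : ℝ → ℝ} {ℓ M R : ℝ}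
    (hT : Cutoff ℓ M T T1 T2) (hσ : IsSawtooth σ) (hM : 0 ≤ M) (hℓ : 0 < ℓ) (hℓ1 : ℓ ≤ 1)
    (hR : 1 ≤ R) (hRℓ : R⁻¹ ^ 4 / 4 ≤ ℓ / 8) {X ρ N ε e r η : ℝ} {h a b c f : ℝ × ℝ → ℝ}
    (hε : 0 ≤ ε) (hN : 1 ≤ N) (he : 0 < e) (hr : 0 < r) (hre : 4 * N * r ≤ e)
    (hℓr : 5 * ℓ ≤ r) (hℓe : 20 * N * ℓ ≤ e * r) (hη : 0 ≤ η) (hη1 : η ≤ 1)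
    (hX : |X| ≤ 1) (hρ1 : ρ ≤ 1) (hrρ : r ≤ ρ / 4) (hU : square X (3 * ρ / 4) ⊆ U)
    (hb : ∀ z ∈ square X (3 * ρ / 4), |u z| ≤ N ∧ |p z| ≤ N ∧ |q z| ≤ N ∧
      |E z| ≤ N ∧ |F z| ≤ N ∧ |G z| ≤ N ∧ |Ex z| ≤ N ∧ |Ey z| ≤ N)
    (hh : ∀ z, HasGrad h z (a z) (2 * b z)) (hac : Continuous a) (hbc : Continuous b)
    (ha1 : ∀ z, |a z| ≤ 1)
    (hab : ∀ z : ℝ × ℝ, (ρ / 4 ≤ |z.1 - X| ∨ ρ / 4 ≤ |z.2|) → h z = 0 ∧ a z = 0 ∧ b z = 0)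
    (hc : ∀ z ∈ square X (3 * ρ / 4), c z = packetCoeff σ ℓ R ε z.1 z.2 (u z) (p z))
    (hcη : ∀ z ∈ square X (3 * ρ / 4), |c z| ≤ η) (hRη : R⁻¹ ^ 7 ≤ η)
    (hf : ∀ z ∈ square X (3 * ρ / 4), -R⁻¹ ^ 7 ≤ f z)
    (hf' : ∀ z ∈ square X (3 * ρ / 4), (ρ / 4 ≤ |z.1 - X| ∨ ρ / 4 ≤ |z.2|) → f z = -R⁻¹ ^ 7)
    (heq : ∀ z ∈ square X (3 * ρ / 4), (E z + a z) * (G z + c z) - (F z + b z) ^ 2 = f z)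
    (hlarge : 3 * N * (3 * N) * (20 * M * R ^ 4 * Real.exp (-(ℓ ^ 2 / 128 * R)))
      < ε * R⁻¹ ^ 8 / 64)
    (hsmall : 2 * N * e + 2 * N * √(e * (N + 1) + η) + η * (N + 2)
      < ∫ z in square X (ρ / 2), b z ^ 2) : False := by
  have hρ : 0 < ρ := by linarith
  have hsub : square X (ρ / 2) ⊆ square X (3 * ρ / 4) := fun z hz => by
    rw [mem_square] at hz ⊢
    exact ⟨hz.1.trans (by linarith), hz.2.trans (by linarith)⟩
  refine absurd hsmall (not_lt.2 ?_)
  refine J.integral_sq_le (c := c) (f := f) (by linarith) (by linarith) (by linarith) (by linarith)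
    (hsub.trans hU) hh hac hbc (by linarith) he.le (Real.sqrt_nonneg _) hη
    (fun z hz => (hb z (hsub hz)).2.2.1) (fun z hz => (hb z (hsub hz)).2.2.2.1)
    (fun z _ => ha1 z) (fun z hz => hcη z (hsub hz))
    (fun z hz => by linarith [hf z (hsub hz)]) (fun z hz => heq z (hsub hz)) ?_
  intro z hz hbd
  have hzQ := mem_square.1 hz
  have hzb : ρ / 2 ≤ |z.1 - X| ∨ ρ / 2 ≤ |z.2| := by
    rcases hbd with hbd | hbd | hbd | hbd
    · left; rw [hbd]; exact le_trans (by linarith) (neg_le_abs _)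
    · left; rw [hbd]; exact le_trans (by linarith) (le_abs_self _)
    · right; rw [hbd]; exact le_trans (by linarith) (neg_le_abs _)
    · right; rw [hbd]; exact le_trans (by linarith) (le_abs_self _)
  have hbox : ∀ w ∈ Icc (z.1 - r) (z.1 + r) ×ˢ Icc (z.2 - r) (z.2 + r),
      w ∈ square X (3 * ρ / 4) ∧ (ρ / 4 ≤ |w.1 - X| ∨ ρ / 4 ≤ |w.2|) := by
    intro w hw
    have d1 : |w.1 - z.1| ≤ r := by rw [abs_le]; constructor <;> linarith [hw.1.1, hw.1.2]
    have d2 : |w.2 - z.2| ≤ r := by rw [abs_le]; constructor <;> linarith [hw.2.1, hw.2.2]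
    have t1 := abs_sub_le w.1 z.1 X
    have t2 := abs_sub_le z.1 w.1 X
    have t3 := abs_sub_abs_le_abs_sub w.2 z.2
    have t4 := abs_sub_abs_le_abs_sub z.2 w.2
    rw [abs_sub_comm z.1 w.1] at t2
    rw [abs_sub_comm z.2 w.2] at t4
    refine ⟨mem_square.2 ⟨by linarith, by linarith⟩, ?_⟩
    rcases hzb with h1 | h1
    · left; linarith
    · right; linarith
  have heqb : ∀ w ∈ Icc (z.1 - r) (z.1 + r) ×ˢ Icc (z.2 - r) (z.2 + r),
      E w * (G w + c w) - F w ^ 2 = -R⁻¹ ^ 7 := by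
    intro w hw
    obtain ⟨h1, h2⟩ := hbox w hw
    have e1 := heq w h1
    obtain ⟨-, e2, e3⟩ := hab w h2
    rwa [e2, e3, hf' w h1 h2, add_zero, add_zero] at e1
  have hE : |E z| < e := by
    refine J.abs_uxx_lt (x₀ := z.1) (y₀ := z.2) hT hσ hM hℓ hℓ1 hR hRℓ hε hN hr
      (by linarith) hre hℓr hℓe
      (fun w hw => hU (hbox w hw).1) (fun w hw => ?_) (fun w hw => ?_)
      (fun w hw => hc w (hbox w hw).1) heqb hlarge
    · have := (mem_square.1 (hbox w hw).1).1
      have t := abs_add_le (w.1 - X) X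
      rw [sub_add_cancel] at t
      linarith
    · have := hb w (hbox w hw).1
      tauto
  obtain ⟨h0, a0, b0⟩ := hab z (hzb.imp (fun h => by linarith) fun h => by linarith)
  refine ⟨h0, hE.le, ?_⟩
  -- In the ring the equation reads `F² = E (G + c) + R⁻⁷`, so smallness of `E` passes to `F`.
  have e1 := heqb z ⟨⟨by linarith, by linarith⟩, ⟨by linarith, by linarith⟩⟩
  refine Real.le_sqrt_of_sq_le ?_
  rw [sq_abs]
  have hG : |G z + c z| ≤ N + 1 :=
    (abs_add_le _ _).trans (add_le_add (hb z (hsub hz)).2.2.2.2.2.1 ((hcη z (hsub hz)).trans hη1))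
  have : |E z * (G z + c z)| ≤ e * (N + 1) := by
    rw [abs_mul]; exact mul_le_mul hE.le hG (abs_nonneg _) he.le
  linarith [le_abs_self (E z * (G z + c z))]

/-! ### Functions with bounded derivatives -/

section Bounded

variable {E V : Type*} [NormedAddCommGroup E] [NormedSpace ℝ E] [NormedAddCommGroup V]
  [NormedSpace ℝ V]

/-- All derivatives of `f` up to order `n` are bounded by `C`. -/
def DerivBound (n : ℕ) (C : ℝ) (f : E → V) : Prop :=
  ∀ k ≤ n, ∀ x, ‖iteratedFDeriv ℝ k f x‖ ≤ C

/-- A smooth function all of whose derivatives are bounded. -/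
def SmoothBdd (f : E → V) : Prop :=
  ContDiff ℝ ∞ f ∧ ∀ k, ∃ C, ∀ x, ‖iteratedFDeriv ℝ k f x‖ ≤ C

theorem DerivBound.norm_le {n : ℕ} {C : ℝ} {f : E → V} (h : DerivBound n C f) (x : E) :
    ‖f x‖ ≤ C := by
  simpa using h 0 (Nat.zero_le _) x

theorem DerivBound.mono {n : ℕ} {C D : ℝ} {f : E → V} (h : DerivBound n C f) (hCD : C ≤ D) :
    DerivBound n D f := fun k hk x => (h k hk x).trans hCD

theorem DerivBound.add {n : ℕ} {C D : ℝ} {f g : E → V} (hf : DerivBound n C f)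
    (hg : DerivBound n D g) (sf : ContDiff ℝ ∞ f) (sg : ContDiff ℝ ∞ g) :
    DerivBound n (C + D) (fun x => f x + g x) := by
  intro k hk x
  have := fun_iteratedFDeriv_add_apply (x := x) (i := k) (𝕜 := ℝ) (f := f) (g := g)
    ((sf.of_le (by exact_mod_cast le_top)).contDiffAt)
    ((sg.of_le (by exact_mod_cast le_top)).contDiffAt)
  rw [this]
  exact (norm_add_le _ _).trans (add_le_add (hf k hk x) (hg k hk x))

theorem DerivBound.const_mul {n : ℕ} {C : ℝ} {f : E → ℝ} (hf : DerivBound n C f)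
    (sf : ContDiff ℝ ∞ f) (c : ℝ) : DerivBound n (|c| * C) (fun x => c * f x) := by
  intro k hk x
  have := iteratedFDeriv_const_smul_apply' (x := x) (i := k) (𝕜 := ℝ) (f := f) (a := c)
    ((sf.of_le (by exact_mod_cast le_top)).contDiffAt)
  simp only [smul_eq_mul] at this
  rw [this, norm_smul, Real.norm_eq_abs]
  exact mul_le_mul_of_nonneg_left (hf k hk x) (abs_nonneg _)

theorem DerivBound.mul {n : ℕ} {C D : ℝ} {f g : E → ℝ} (hf : DerivBound n C f)
    (hg : DerivBound n D g) (sf : ContDiff ℝ ∞ f) (sg : ContDiff ℝ ∞ g) :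
    DerivBound n (2 ^ n * (C * D)) (fun x => f x * g x) := by
  intro k hk x
  have hC : 0 ≤ C := (norm_nonneg _).trans (hf 0 (Nat.zero_le _) x)
  have hD : 0 ≤ D := (norm_nonneg _).trans (hg 0 (Nat.zero_le _) x)
  refine (norm_iteratedFDeriv_mul_le sf sg x (n := k) (by exact_mod_cast le_top)).trans ?_
  calc ∑ i ∈ Finset.range (k + 1), (k.choose i : ℝ) * ‖iteratedFDeriv ℝ i f x‖ *
        ‖iteratedFDeriv ℝ (k - i) g x‖
      ≤ ∑ i ∈ Finset.range (k + 1), (k.choose i : ℝ) * (C * D) := by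
        refine Finset.sum_le_sum fun i hi => ?_
        rw [mul_assoc]
        have := Finset.mem_range_succ_iff.1 hi
        exact mul_le_mul_of_nonneg_left (mul_le_mul (hf i (by omega) x) (hg _ (by omega) x)
          (norm_nonneg _) hC) (by positivity)
    _ = 2 ^ k * (C * D) := by
        rw [← Finset.sum_mul, ← Nat.cast_sum, Nat.sum_range_choose]; norm_num
    _ ≤ 2 ^ n * (C * D) :=
        mul_le_mul_of_nonneg_right (pow_le_pow_right₀ (by norm_num) hk) (by positivity)

theorem SmoothBdd.exists_derivBound {f : E → V} (h : SmoothBdd f) (n : ℕ) :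
    ∃ C, 0 ≤ C ∧ DerivBound n C f := by
  choose C hC using h.2
  refine ⟨∑ k ∈ Finset.range (n + 1), |C k|, by positivity, fun k hk x => ?_⟩
  refine ((hC k x).trans (le_abs_self _)).trans ?_
  exact Finset.single_le_sum (f := fun k => |C k|) (fun _ _ => abs_nonneg _)
    (Finset.mem_range_succ_iff.2 hk)

theorem smoothBdd_of_derivBound {f : E → V} (sf : ContDiff ℝ ∞ f)
    (h : ∀ n, ∃ C, DerivBound n C f) : SmoothBdd f :=
  ⟨sf, fun k => (h k).imp fun _ hC => hC k le_rfl⟩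

theorem SmoothBdd.const (c : V) : SmoothBdd (fun _ : E => c) := by
  refine ⟨contDiff_const, fun k => ⟨‖c‖, fun x => ?_⟩⟩
  rcases Nat.eq_zero_or_pos k with rfl | hk
  · simp
  · rw [iteratedFDeriv_const_of_ne (by omega)]
    simp

theorem SmoothBdd.mul {f g : E → ℝ} (hf : SmoothBdd f) (hg : SmoothBdd g) :
    SmoothBdd (fun x => f x * g x) := by
  refine smoothBdd_of_derivBound (hf.1.mul hg.1) fun n => ?_
  obtain ⟨C, -, hC⟩ := hf.exists_derivBound n
  obtain ⟨D, -, hD⟩ := hg.exists_derivBound n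
  exact ⟨_, hC.mul hD hf.1 hg.1⟩

theorem SmoothBdd.pow {f : E → ℝ} (hf : SmoothBdd f) (m : ℕ) : SmoothBdd (fun x => f x ^ m) := by
  induction m with
  | zero => simpa using SmoothBdd.const (1 : ℝ)
  | succ m ih => simpa only [pow_succ] using ih.mul hf

/-- The derivatives of a composition, in terms of a bound for those of the inner function. -/
theorem DerivBound.comp {n : ℕ} {C D : ℝ} {g : ℝ → ℝ} {f : E → ℝ} (hg : DerivBound n C g)
    (sg : ContDiff ℝ ∞ g) (sf : ContDiff ℝ ∞ f) (hD : 1 ≤ D)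
    (hf : ∀ k, 1 ≤ k → k ≤ n → ∀ x, ‖iteratedFDeriv ℝ k f x‖ ≤ D) :
    DerivBound n (n.factorial * C * D ^ n) (fun x => g (f x)) := by
  intro k hk x
  have hC : 0 ≤ C := (norm_nonneg _).trans (hg 0 (Nat.zero_le _) 0)
  refine (norm_iteratedFDeriv_comp_le sg sf (n := k) (by exact_mod_cast le_top) x (C := C) (D := D)
    (fun i hi => hg i (hi.trans hk) _) fun i h1 hi => ?_).trans ?_
  · exact (hf i h1 (hi.trans hk) x).trans (le_self_pow₀ hD (by omega))
  · gcongr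

/-- Boundedness is asked only of the derivative of the inner function, so that unbounded affine
arguments are allowed. -/
theorem SmoothBdd.comp {g : ℝ → ℝ} {f : E → ℝ} (hg : SmoothBdd g) (sf : ContDiff ℝ ∞ f)
    (hf : SmoothBdd (fderiv ℝ f)) : SmoothBdd (fun x => g (f x)) := by
  refine smoothBdd_of_derivBound (hg.1.comp sf) fun n => ?_
  obtain ⟨C, -, hC⟩ := hg.exists_derivBound n
  obtain ⟨D, hD0, hD⟩ := hf.exists_derivBound n
  refine ⟨_, hC.comp hg.1 sf (D := D + 1) (by linarith) fun k h1 hk x => ?_⟩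
  obtain ⟨j, rfl⟩ : ∃ j, k = j + 1 := ⟨k - 1, by omega⟩
  rw [← norm_iteratedFDeriv_fderiv]
  linarith [hD j (by omega) x]

theorem SmoothBdd.comp_affine {g : ℝ → ℝ} (hg : SmoothBdd g) (L : E →L[ℝ] ℝ) (c d : ℝ) :
    SmoothBdd (fun x => g (c * L x + d)) := by
  refine hg.comp (f := fun x => c * L x + d) (by fun_prop) ?_
  have : fderiv ℝ (fun x => c * L x + d) = fun _ => c • L := by
    funext x
    have := ((L.hasFDerivAt (x := x)).const_mul c).add_const d
    exact this.fderiv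
  rw [this]
  exact SmoothBdd.const _

theorem SmoothBdd.fderiv {f : E → V} (hf : SmoothBdd f) : SmoothBdd (fderiv ℝ f) :=
  ⟨hf.1.fderiv_right (by simp), fun k => (hf.2 (k + 1)).imp fun C hC x => by
    rw [norm_iteratedFDeriv_fderiv]; exact hC x⟩

end Bounded

theorem smoothBdd_of_hasCompactSupport {f : ℝ → ℝ} (sf : ContDiff ℝ ∞ f)
    (hf : HasCompactSupport f) : SmoothBdd f :=
  ⟨sf, fun k => (hf.iteratedFDeriv k).exists_bound_of_continuous
    (sf.continuous_iteratedFDeriv (by exact_mod_cast le_top))⟩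

theorem abs_iteratedDeriv_sin_cos_le (k : ℕ) :
    (∀ x, |iteratedDeriv k Real.sin x| ≤ 1) ∧ ∀ x, |iteratedDeriv k Real.cos x| ≤ 1 := by
  induction k with
  | zero => simpa using ⟨Real.abs_sin_le_one, Real.abs_cos_le_one⟩
  | succ k ih =>
    refine ⟨fun x => ?_, fun x => ?_⟩
    · rw [iteratedDeriv_succ', Real.deriv_sin]
      exact ih.2 x
    · rw [iteratedDeriv_succ', Real.deriv_cos']
      rw [show (fun x => -Real.sin x) = -Real.sin from rfl, iteratedDeriv_neg, abs_neg]
      exact ih.1 x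

theorem smoothBdd_sin : SmoothBdd Real.sin :=
  ⟨Real.contDiff_sin, fun k => ⟨1, fun x => by
    rw [norm_iteratedFDeriv_eq_norm_iteratedDeriv]
    exact (abs_iteratedDeriv_sin_cos_le k).1 x⟩⟩

theorem derivBound_cos (n : ℕ) : DerivBound n 1 Real.cos := fun k _ x => by
  rw [norm_iteratedFDeriv_eq_norm_iteratedDeriv]
  exact (abs_iteratedDeriv_sin_cos_le k).2 x

/-! ### Sawtooth and cutoff functions -/

/-- A smooth bounded periodic function that is the identity modulo `2π` near `2πℤ`. -/
theorem exists_sawtooth : ∃ σ : ℝ → ℝ, SmoothBdd σ ∧ IsSawtooth σ := by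
  let B : ContDiffBump (0 : ℝ) := ⟨1 / 2, 3 / 4, by norm_num, by norm_num⟩
  -- The sawtooth is `H ∘ sin`. The bump removes the singularities of `arcsin` at `±1` and equals
  -- one for `|s| ≤ 1 / 2`, hence at `sin t` for `|t| ≤ 1 / 2`.
  let H : ℝ → ℝ := fun s => B s * Real.arcsin s
  have sH : ContDiff ℝ ∞ H := by
    rw [contDiff_iff_contDiffAt]
    intro s
    by_cases hs : |s| < 1
    · obtain ⟨h1, h2⟩ := abs_lt.1 hs
      exact B.contDiffAt.mul (Real.contDiffAt_arcsin (by linarith) (by linarith))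
    · have : H =ᶠ[𝓝 s] fun _ => 0 := by
        have : ∀ᶠ t in 𝓝 s, 3 / 4 < |t| :=
          continuous_abs.continuousAt.eventually (lt_mem_nhds (by linarith [not_lt.1 hs]))
        filter_upwards [this] with t ht
        have : B t = 0 := B.zero_of_le_dist (by simpa [B] using ht.le)
        simp [H, this]
      exact contDiffAt_const.congr_of_eventuallyEq this
  have cH : HasCompactSupport H := B.hasCompactSupport.mul_right
  refine ⟨fun t => H (Real.sin t), (smoothBdd_of_hasCompactSupport sH cH).comp
    Real.contDiff_sin smoothBdd_sin.fderiv, fun k t ht => ?_⟩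
  have hsin : Real.sin (k * (2 * Real.pi) + t) = Real.sin t := by
    rw [add_comm, Real.sin_add_int_mul_two_pi]
  have h1 : B (Real.sin t) = 1 := by
    refine B.one_of_mem_closedBall ?_
    simpa [B] using (Real.abs_sin_le_abs (x := t)).trans (by linarith)
  obtain ⟨h2, h3⟩ := abs_le.1 ht
  have := Real.pi_gt_three
  simp only [hsin, H, h1, one_mul]
  exact Real.arcsin_sin (by linarith) (by linarith)

theorem exists_cutoff {ℓ : ℝ} (hℓ : 0 < ℓ) :
    ∃ (M : ℝ) (T T1 T2 : ℝ → ℝ), 0 < M ∧ Cutoff ℓ M T T1 T2 := by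
  let B : ContDiffBump (0 : ℝ) := ⟨ℓ / 6, ℓ / 3, by positivity, by linarith⟩
  have sB : ContDiff ℝ ∞ B := B.contDiff
  have cB : HasCompactSupport B := B.hasCompactSupport
  have s1 : ContDiff ℝ ∞ (deriv B) := sB.iterate_deriv 1
  have s2 : ContDiff ℝ ∞ (deriv (deriv B)) := sB.iterate_deriv 2
  obtain ⟨M1, hM1⟩ := cB.deriv.exists_bound_of_continuous s1.continuous
  obtain ⟨M2, hM2⟩ := cB.deriv.deriv.exists_bound_of_continuous s2.continuous
  have loc : ∀ (t c : ℝ), (B : ℝ → ℝ) =ᶠ[𝓝 t] (fun _ => c) →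
      B t = c ∧ deriv B t = 0 ∧ deriv (deriv B) t = 0 := by
    intro t c h
    refine ⟨h.eq_of_nhds, ?_, ?_⟩
    · rw [h.deriv_eq]; simp
    · rw [h.deriv.deriv_eq]; simp
  refine ⟨|M1| + |M2| + 1, B, deriv B, deriv (deriv B), by positivity,
    fun t => (sB.differentiable (by simp)).differentiableAt.hasDerivAt,
    fun t => (s1.differentiable (by simp)).differentiableAt.hasDerivAt, s2.continuous,
    fun t ht => loc t 1 ?_, fun t ht => loc t 0 ?_, fun t => B.nonneg, fun t => B.le_one,
    fun t => ?_, fun t => ?_⟩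
  · have : ∀ᶠ s in 𝓝 t, |s| < ℓ / 6 :=
      continuous_abs.continuousAt.eventually (gt_mem_nhds (by linarith))
    filter_upwards [this] with s hs
    exact B.one_of_mem_closedBall (by simpa [B] using hs.le)
  · have : ∀ᶠ s in 𝓝 t, ℓ / 3 < |s| :=
      continuous_abs.continuousAt.eventually (lt_mem_nhds (by linarith))
    filter_upwards [this] with s hs
    exact B.zero_of_le_dist (by simpa [B] using hs.le)
  · have := hM1 t
    rw [Real.norm_eq_abs] at this
    linarith [le_abs_self M1, abs_nonneg M2]
  · have := hM2 t
    rw [Real.norm_eq_abs] at this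
    linarith [le_abs_self M2, abs_nonneg M1]

/-! ### Choice of parameters on one square -/

/-- A smooth function on `ℝ⁵` with derivatives up to order `n` at most `δ`, supported over the
square with centre `(X, 0)` and half side `ρ`. -/
structure IsFlat (n : ℕ) (X ρ δ : ℝ) (g : R5 → ℝ) : Prop where
  smooth : ContDiff ℝ ∞ g
  bound : DerivBound n δ g
  support : ∀ w : R5, (w.1, w.2.1) ∉ square X ρ → g w = 0

/-- The derivatives of `u` up to order three that matter are bounded by `N` on `K`. -/
def JetBound (N : ℝ) (K : Set (ℝ × ℝ)) (u : ℝ × ℝ → ℝ) : Prop :=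
  ∀ z ∈ K, |u z| ≤ N ∧ |dx u z| ≤ N ∧ |dy u z| ≤ N ∧ |dx (dx u) z| ≤ N ∧ |dy (dx u) z| ≤ N ∧
    |dy (dy u) z| ≤ N ∧ |dx (dx (dx u)) z| ≤ N ∧ |dy (dx (dx u)) z| ≤ N

/-- The coefficient `c` assembled from its parts. -/
def lowerOrder (c₀ β γ : R5 → ℝ) (w : R5) : ℝ :=
  c₀ w + β w * w.1 + γ w * (w.1 * w.2.2.2.1 - w.2.2.1)

/-- Coefficients living over one square for which there is no solution with derivatives bounded
by `N`. -/
structure IsObstruction (n : ℕ) (X ρ δ N : ℝ) (a b c₀ β γ φ ψ : R5 → ℝ) : Prop where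
  flat_a : IsFlat n X ρ δ a
  flat_b : IsFlat n X ρ δ b
  flat_c : IsFlat n X ρ δ c₀
  flat_β : IsFlat n X ρ δ β
  flat_γ : IsFlat n X ρ δ γ
  flat_φ : IsFlat n X ρ δ φ
  flat_ψ : IsFlat n X ρ δ ψ
  φ_nonneg : ∀ w, 0 ≤ φ w
  φ_lt_ψ : ∀ z r q, φ (X, 0, z, r, q) < ψ (X, 0, z, r, q)
  ψ_lt_φ : ∀ z r q, ψ (X + ρ / 2, 0, z, r, q) = 0 ∧ 0 < φ (X + ρ / 2, 0, z, r, q)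
  no_solution : ∀ s : ℝ, (s = 0 ∨ s = 1) → ∀ (U : Set (ℝ × ℝ)) (u : ℝ × ℝ → ℝ), IsOpen U →
    square X ρ ⊆ U → ContDiffOn ℝ 3 u U → JetBound N (square X ρ) u →
    ¬ ∀ z ∈ square X ρ, (dx (dx u) z + a (jet u z)) *
      (dy (dy u) z + lowerOrder c₀ β γ (jet u z)) - (dy (dx u) z + b (jet u z)) ^ 2
        = s * ψ (jet u z) - φ (jet u z)

/-- The exponential beats every power of `R`. The left side is the packet error and the right side
the source contribution, for source amplitude `R⁻ᵏ`. -/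
theorem exists_frequency (k : ℕ) (A : ℝ) {b t : ℝ} (hb : 0 < b) (ht : 0 < t) :
    ∃ R : ℝ, 1 ≤ R ∧ R⁻¹ ≤ t ∧ A * R ^ 4 * Real.exp (-(b * R)) < R⁻¹ ^ k * R⁻¹ ^ 8 / 64 := by
  have h1 : ∀ᶠ R : ℝ in Filter.atTop, 1 ≤ R := Filter.eventually_ge_atTop 1
  have h2 : ∀ᶠ R : ℝ in Filter.atTop, R⁻¹ ≤ t :=
    (tendsto_inv_atTop_zero (𝕜 := ℝ)).eventually (ge_mem_nhds ht)
  have h3 := (isLittleO_pow_exp_pos_mul_atTop (k + 12) hb).bound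
    (c := 1 / (128 * (|A| + 1))) (by positivity)
  obtain ⟨R, hR, hR2, hR3⟩ := (h1.and (h2.and h3)).exists
  refine ⟨R, hR, hR2, ?_⟩
  have hR0 : 0 < R := by linarith
  rw [Real.norm_eq_abs, Real.norm_eq_abs, abs_of_pos (by positivity),
    abs_of_pos (Real.exp_pos _)] at hR3
  rw [Real.exp_neg]
  have he := Real.exp_pos (b * R)
  set e := Real.exp (b * R)
  have h4 : |A| * R ^ (k + 12) < e / 64 := by
    have : (|A| + 1) * R ^ (k + 12) ≤ e / 128 := by
      calc (|A| + 1) * R ^ (k + 12) ≤ (|A| + 1) * (1 / (128 * (|A| + 1)) * e) := by gcongr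
        _ = e / 128 := by field_simp
    have hp : 0 < R ^ (k + 12) := by positivity
    nlinarith
  have h5 : A * R ^ (k + 12) < e / 64 :=
    lt_of_le_of_lt (mul_le_mul_of_nonneg_right (le_abs_self A) (by positivity)) h4
  have e1 : R⁻¹ ^ k * R⁻¹ ^ 8 / 64 - A * R ^ 4 * e⁻¹
      = (e / 64 - A * R ^ (k + 12)) / (R ^ (k + 8) * e) := by
    simp only [inv_pow]
    field_simp
    ring
  have : 0 < (e / 64 - A * R ^ (k + 12)) / (R ^ (k + 8) * e) :=
    div_pos (by linarith) (by positivity)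
  linarith

/-- The left side is the bound of `Jet3.integral_sq_le` with `η = e`; it is continuous in `e` and
vanishes at zero. -/
theorem exists_threshold {N I : ℝ} (hI : 0 < I) :
    ∃ e : ℝ, 0 < e ∧ e ≤ 1 ∧ 2 * N * e + 2 * N * √(e * (N + 1) + e) + e * (N + 2) < I := by
  have hc : Continuous fun e : ℝ => 2 * N * e + 2 * N * √(e * (N + 1) + e) + e * (N + 2) := by
    fun_prop
  have h1 : ∀ᶠ e in 𝓝[>] (0 : ℝ),
      2 * N * e + 2 * N * √(e * (N + 1) + e) + e * (N + 2) < I := by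
    exact nhdsWithin_le_nhds ((hc.tendsto' 0 0 (by simp)).eventually (gt_mem_nhds hI))
  have h2 : ∀ᶠ e in 𝓝[>] (0 : ℝ), e ≤ 1 := nhdsWithin_le_nhds (ge_mem_nhds one_pos)
  have h3 : ∀ᶠ e in 𝓝[>] (0 : ℝ), 0 < e := self_mem_nhdsWithin
  obtain ⟨e, he1, he2, he3⟩ := (h1.and (h2.and h3)).exists
  exact ⟨e, he3, he2, he1⟩

/-- Uniform estimates, as the frequency grows, for the coefficients built from the wave packet. -/
theorem exists_packet_bound (n : ℕ) {χ Y Z : R5 → ℝ} (hχ : SmoothBdd χ) (hY : SmoothBdd Y)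
    (hZ : SmoothBdd Z) : ∃ C : ℝ, 0 ≤ C ∧ ∀ R : ℝ, 1 ≤ R →
      DerivBound n (C * R⁻¹) (fun w => R⁻¹ ^ (4 * n + 1) * (χ w * Real.cos (phase R (Z w, Y w)))) ∧
      DerivBound n (C * R⁻¹) (fun w => χ w * beta0 R (Z w, Y w)) ∧
      DerivBound n (C * R⁻¹) (fun w => χ w * gamma0 R (Z w, Y w)) ∧
      DerivBound n (C * R⁻¹) (fun w => R⁻¹ ^ 7 * χ w) := by
  obtain ⟨C0, hC0, b0⟩ := hχ.exists_derivBound n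
  obtain ⟨CY, hCY, bY⟩ := (hY.pow 2).exists_derivBound n
  obtain ⟨CZ, hCZ, bZ⟩ := hZ.exists_derivBound n
  obtain ⟨C1, hC1, b1⟩ := (hχ.mul (hY.pow 2)).exists_derivBound n
  obtain ⟨C2, hC2, b2⟩ := (hχ.mul hZ).exists_derivBound n
  obtain ⟨C3, hC3, b3⟩ := (hχ.mul (hZ.pow 2)).exists_derivBound n
  obtain ⟨C4, hC4, b4⟩ := (hχ.mul ((hY.pow 2).mul hZ)).exists_derivBound n
  set D := CZ + CY + 1 with hD
  set K := 2 ^ n * (C0 * (n.factorial * 1 * D ^ n)) with hK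
  refine ⟨K + 2 * (C0 + C1 + C2 + C3 + C4), by positivity, fun R hR => ?_⟩
  have hR0 : 0 < R := by linarith
  have i1 : R⁻¹ ≤ 1 := inv_le_one_of_one_le₀ hR
  have i0 : 0 ≤ R⁻¹ := by positivity
  have ip : ∀ k, k ≠ 0 → |R⁻¹ ^ k| ≤ R⁻¹ := fun k hk => by
    rw [abs_of_nonneg (by positivity)]; exact pow_le_of_le_one i0 i1 hk
  have K0 : 0 ≤ K := by positivity
  refine ⟨?_, ?_, ?_, ?_⟩
  · have sp : ContDiff ℝ ∞ fun w => phase R (Z w, Y w) := by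
      have := hY.1
      have := hZ.1
      unfold phase
      fun_prop
    have bp : DerivBound n (R ^ 4 * D) fun w => phase R (Z w, Y w) := by
      have h := (bZ.const_mul hZ.1 (R ^ 4)).add (bY.const_mul (hY.pow 2).1 (-(R / 2)))
        (contDiff_const.mul hZ.1) (contDiff_const.mul (hY.pow 2).1)
      have e : (fun w => phase R (Z w, Y w)) = fun w => R ^ 4 * Z w + -(R / 2) * Y w ^ 2 := by
        funext w; simp only [phase]; ring
      rw [e]
      refine h.mono ?_
      rw [abs_neg, abs_of_pos (by positivity), abs_of_pos (by positivity)]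
      have : R ≤ R ^ 4 := le_self_pow₀ hR (by norm_num)
      nlinarith
    have R4 : 1 ≤ R ^ 4 := one_le_pow₀ hR
    have bc := (derivBound_cos n).comp Real.contDiff_cos sp (D := R ^ 4 * D)
      (by nlinarith) (fun k _ hk x => bp k hk x)
    have sc : ContDiff ℝ ∞ fun w => Real.cos (phase R (Z w, Y w)) := Real.contDiff_cos.comp sp
    refine ((b0.mul bc hχ.1 sc).const_mul (hχ.1.mul sc) _).mono ?_
    rw [abs_of_nonneg (by positivity)]
    -- Up to `n` derivatives of the cosine, whose phase has size `R⁴`, cost at most `R⁴ⁿ`; the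
    -- exponent `4n + 1` leaves one factor `R⁻¹` to spare.
    have e : R⁻¹ ^ (4 * n + 1) * (2 ^ n * (C0 * (n.factorial * 1 * (R ^ 4 * D) ^ n)))
        = K * R⁻¹ := by
      rw [hK, mul_pow, pow_succ, pow_mul]
      have : (R⁻¹ ^ 4) ^ n * (R ^ 4) ^ n = 1 := by
        rw [← mul_pow, ← mul_pow, inv_mul_cancel₀ hR0.ne']; simp
      linear_combination (R⁻¹ * 2 ^ n * C0 * n.factorial * D ^ n) * this
    rw [e]
    gcongr
    linarith
  · have h := ((b0.const_mul hχ.1 (R⁻¹ ^ 3)).add (b1.const_mul (hχ.mul (hY.pow 2)).1 (-2 * R⁻¹ ^ 2))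
      (contDiff_const.mul hχ.1) (contDiff_const.mul (hχ.mul (hY.pow 2)).1)).add
      (b2.const_mul (hχ.mul hZ).1 (-2 * R⁻¹ ^ 6))
      ((contDiff_const.mul hχ.1).add (contDiff_const.mul (hχ.mul (hY.pow 2)).1))
      (contDiff_const.mul (hχ.mul hZ).1)
    have e : (fun w => χ w * beta0 R (Z w, Y w)) = fun w => R⁻¹ ^ 3 * χ w +
        -2 * R⁻¹ ^ 2 * (χ w * Y w ^ 2) + -2 * R⁻¹ ^ 6 * (χ w * Z w) := by
      funext w; simp only [beta0]; ring
    rw [e]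
    refine h.mono ?_
    rw [abs_mul, abs_mul, abs_neg, abs_two]
    have := ip 3 (by norm_num)
    have := ip 2 (by norm_num)
    have := ip 6 (by norm_num)
    calc |R⁻¹ ^ 3| * C0 + 2 * |R⁻¹ ^ 2| * C1 + 2 * |R⁻¹ ^ 6| * C2
        ≤ R⁻¹ * C0 + 2 * R⁻¹ * C1 + 2 * R⁻¹ * C2 := by gcongr
      _ = (C0 + 2 * C1 + 2 * C2) * R⁻¹ := by ring
      _ ≤ _ := mul_le_mul_of_nonneg_right (by linarith) i0
  · have h := (((b0.const_mul hχ.1 (-R⁻¹ ^ 6)).add (b3.const_mul (hχ.mul (hZ.pow 2)).1 (R⁻¹ ^ 5))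
      (contDiff_const.mul hχ.1) (contDiff_const.mul (hχ.mul (hZ.pow 2)).1)).add
      (b2.const_mul (hχ.mul hZ).1 (-R⁻¹ ^ 2))
      ((contDiff_const.mul hχ.1).add (contDiff_const.mul (hχ.mul (hZ.pow 2)).1))
      (contDiff_const.mul (hχ.mul hZ).1)).add
      (b4.const_mul (hχ.mul ((hY.pow 2).mul hZ)).1 (2 * R⁻¹))
      (((contDiff_const.mul hχ.1).add (contDiff_const.mul (hχ.mul (hZ.pow 2)).1)).add
        (contDiff_const.mul (hχ.mul hZ).1)) (contDiff_const.mul (hχ.mul ((hY.pow 2).mul hZ)).1)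
    have e : (fun w => χ w * gamma0 R (Z w, Y w)) = fun w => -R⁻¹ ^ 6 * χ w +
        R⁻¹ ^ 5 * (χ w * Z w ^ 2) + -R⁻¹ ^ 2 * (χ w * Z w) + 2 * R⁻¹ * (χ w * (Y w ^ 2 * Z w)) := by
      funext w; simp only [gamma0]; ring
    rw [e]
    refine h.mono ?_
    rw [abs_neg, abs_neg, abs_mul, abs_two, abs_of_nonneg i0]
    have := ip 6 (by norm_num)
    have := ip 2 (by norm_num)
    have := ip 5 (by norm_num)
    calc |R⁻¹ ^ 6| * C0 + |R⁻¹ ^ 5| * C3 + |R⁻¹ ^ 2| * C2 + 2 * R⁻¹ * C4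
        ≤ R⁻¹ * C0 + R⁻¹ * C3 + R⁻¹ * C2 + 2 * R⁻¹ * C4 := by gcongr
      _ = (C0 + C3 + C2 + 2 * C4) * R⁻¹ := by ring
      _ ≤ _ := mul_le_mul_of_nonneg_right (by linarith) i0
  · refine (b0.const_mul hχ.1 _).mono ?_
    calc |R⁻¹ ^ 7| * C0 ≤ R⁻¹ * C0 := by gcongr; exact ip 7 (by norm_num)
      _ = C0 * R⁻¹ := by ring
      _ ≤ _ := mul_le_mul_of_nonneg_right (by linarith) i0

/-- The coordinate `x` on `ℝ⁵`. -/
noncomputable def Lx : R5 →L[ℝ] ℝ := ContinuousLinearMap.fst ℝ ℝ _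

/-- The coordinate `y` on `ℝ⁵`. -/
noncomputable def Ly : R5 →L[ℝ] ℝ :=
  (ContinuousLinearMap.fst ℝ ℝ _).comp (ContinuousLinearMap.snd ℝ ℝ _)

/-- The coordinate `u_x` on `ℝ⁵`. -/
noncomputable def Lp : R5 →L[ℝ] ℝ :=
  (ContinuousLinearMap.fst ℝ ℝ ℝ).comp ((ContinuousLinearMap.snd ℝ ℝ _).comp
    ((ContinuousLinearMap.snd ℝ ℝ _).comp (ContinuousLinearMap.snd ℝ ℝ _)))

theorem integral_prod_sq_pos {s t : ℝ → ℝ} {a₁ b₁ a₂ b₂ : ℝ} (h₁ : a₁ < b₁) (h₂ : a₂ < b₂)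
    (hs : Continuous s) (ht : Continuous t) (hs0 : ∃ x ∈ Icc a₁ b₁, s x ≠ 0)
    (ht0 : ∃ y ∈ Icc a₂ b₂, t y ≠ 0) :
    0 < ∫ z in Icc a₁ b₁ ×ˢ Icc a₂ b₂, (s z.1 * t z.2) ^ 2 := by
  have one : ∀ {f : ℝ → ℝ} {a b : ℝ}, a < b → Continuous f → (∃ x ∈ Icc a b, f x ≠ 0) →
      0 < ∫ x in Icc a b, f x ^ 2 := by
    rintro f a b hab hf ⟨x, hx, hfx⟩
    rw [integral_Icc_eq_integral_Ioc, ← intervalIntegral.integral_of_le hab.le]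
    exact intervalIntegral.integral_pos hab (hf.pow 2).continuousOn (fun _ _ => sq_nonneg _)
      ⟨x, hx, by positivity⟩
  simp only [mul_pow]
  rw [Measure.volume_eq_prod, setIntegral_prod_mul (fun x => s x ^ 2) (fun y => t y ^ 2)]
  exact mul_pos (one h₁ hs hs0) (one h₂ ht ht0)

/-- A smooth even plateau function. -/
theorem exists_plateau : ∃ B : ℝ → ℝ, ContDiff ℝ ∞ B ∧ HasCompactSupport B ∧
    (∀ t, |t| ≤ 3 / 4 → B t = 1) ∧ (∀ t, 1 ≤ |t| → B t = 0 ∧ deriv B t = 0) ∧ (∀ t, 0 ≤ B t) ∧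
    ∃ t, |t| < 1 ∧ deriv B t ≠ 0 := by
  let B : ContDiffBump (0 : ℝ) := ⟨3 / 4, 7 / 8, by norm_num, by norm_num⟩
  have sB : ContDiff ℝ ∞ B := B.contDiff
  have one : ∀ t : ℝ, |t| ≤ 3 / 4 → B t = 1 := fun t ht =>
    B.one_of_mem_closedBall (by simpa [B] using ht)
  have zero : ∀ t : ℝ, 7 / 8 ≤ |t| → B t = 0 := fun t ht =>
    B.zero_of_le_dist (by simpa [B] using ht)
  refine ⟨B, sB, B.hasCompactSupport, one, fun t ht => ⟨zero t (by linarith), ?_⟩,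
    fun t => B.nonneg, ?_⟩
  · have : (B : ℝ → ℝ) =ᶠ[𝓝 t] fun _ => 0 := by
      have : ∀ᶠ s in 𝓝 t, 7 / 8 < |s| :=
        continuous_abs.continuousAt.eventually (lt_mem_nhds (by linarith))
      filter_upwards [this] with s hs using zero s hs.le
    rw [this.deriv_eq]; simp
  · obtain ⟨c, hc, hc'⟩ := exists_deriv_eq_slope B (show (0 : ℝ) < 7 / 8 by norm_num)
      sB.continuous.continuousOn (sB.differentiable (by simp)).differentiableOn
    refine ⟨c, by rw [abs_of_pos hc.1]; linarith [hc.2], ?_⟩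
    rw [hc', one 0 (by norm_num), zero (7 / 8) (le_abs_self _)]
    norm_num

-- The order of choices is essential. The amplitude `τ` fixes `a`, `b` and `∫ b²`; then `e`, `r` and
-- `ℓ` are chosen small in terms of these and `N`; the frequency `R` comes last. Thus `c` and `f`
-- can be made negligible while `∫ b²` stays put.
set_option maxHeartbeats 1000000 in
theorem exists_obstruction (n : ℕ) {X ρ δ N : ℝ} (hρ : 0 < ρ) (hρ1 : ρ ≤ 1) (hX : |X| ≤ 1)
    (hδ : 0 < δ) (hN : 1 ≤ N) :
    ∃ a b c₀ β γ φ ψ : R5 → ℝ, IsObstruction n X ρ δ N a b c₀ β γ φ ψ := by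
  obtain ⟨B, sB, cB, B1, B0, Bn, tB, htB, htB'⟩ := exists_plateau
  obtain ⟨σ, bσ, hσ⟩ := exists_sawtooth
  have bB : SmoothBdd B := smoothBdd_of_hasCompactSupport sB cB
  have bB' : SmoothBdd (deriv B) :=
    smoothBdd_of_hasCompactSupport (sB.iterate_deriv 1) cB.deriv
  have hdB : ∀ t, HasDerivAt B (deriv B t) t := fun t =>
    (sB.differentiable (by simp)).differentiableAt.hasDerivAt
  set k := 4 / ρ with hk
  have hk0 : 0 < k := by positivity
  -- the inner bump and its derivatives
  have bψ : SmoothBdd fun w : R5 => B (k * Lx w + -(k * X)) * B (k * Ly w + 0) :=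
    (bB.comp_affine Lx k _).mul (bB.comp_affine Ly k _)
  have ba : SmoothBdd fun w : R5 => k * (deriv B (k * Lx w + -(k * X)) * B (k * Ly w + 0)) :=
    (SmoothBdd.const k).mul ((bB'.comp_affine Lx k _).mul (bB.comp_affine Ly k _))
  have bb : SmoothBdd fun w : R5 =>
      k / 2 * (B (k * Lx w + -(k * X)) * deriv B (k * Ly w + 0)) :=
    (SmoothBdd.const (k / 2)).mul ((bB.comp_affine Lx k _).mul (bB'.comp_affine Ly k _))
  have bχ : SmoothBdd fun w : R5 => B (ρ⁻¹ * Lx w + -(ρ⁻¹ * X)) * B (ρ⁻¹ * Ly w + 0) :=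
    (bB.comp_affine Lx ρ⁻¹ _).mul (bB.comp_affine Ly ρ⁻¹ _)
  set ψ₀ : R5 → ℝ := fun w => B (k * Lx w + -(k * X)) * B (k * Ly w + 0) with hψ₀
  set a₀ : R5 → ℝ := fun w => k * (deriv B (k * Lx w + -(k * X)) * B (k * Ly w + 0)) with ha₀
  set b₀ : R5 → ℝ := fun w => k / 2 * (B (k * Lx w + -(k * X)) * deriv B (k * Ly w + 0)) with hb₀
  set χ : R5 → ℝ := fun w => B (ρ⁻¹ * Lx w + -(ρ⁻¹ * X)) * B (ρ⁻¹ * Ly w + 0) with hχ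
  have lx : ∀ w : R5, Lx w = w.1 := fun _ => rfl
  have ly : ∀ w : R5, Ly w = w.2.1 := fun _ => rfl
  have lp : ∀ w : R5, Lp w = w.2.2.2.1 := fun _ => rfl
  have kabs : ∀ t : ℝ, ρ / 4 ≤ |t| → 1 ≤ |k * t| := fun t ht => by
    rw [abs_mul, abs_of_pos hk0, hk, div_mul_eq_mul_div, le_div_iff₀ hρ]; linarith
  have out : ∀ w : R5, (ρ / 4 ≤ |w.1 - X| ∨ ρ / 4 ≤ |w.2.1|) → ψ₀ w = 0 ∧ a₀ w = 0 ∧ b₀ w = 0 := by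
    rintro w (h | h)
    · obtain ⟨e1, e2⟩ := B0 (k * w.1 + -(k * X)) (by
        rw [← sub_eq_add_neg, ← mul_sub]; exact kabs _ h)
      simp [hψ₀, ha₀, hb₀, lx, e1, e2]
    · obtain ⟨e1, e2⟩ := B0 (k * w.2.1 + 0) (by rw [add_zero]; exact kabs _ h)
      rw [add_zero] at e1 e2
      simp [hψ₀, ha₀, hb₀, ly, e1, e2]
  have notmem : ∀ w : R5, (w.1, w.2.1) ∉ square X ρ → ρ ≤ |w.1 - X| ∨ ρ ≤ |w.2.1| := by
    intro w hw
    rw [mem_square, not_and_or, not_le, not_le] at hw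
    exact hw.imp le_of_lt le_of_lt
  have out' : ∀ w : R5, (w.1, w.2.1) ∉ square X ρ → ψ₀ w = 0 ∧ a₀ w = 0 ∧ b₀ w = 0 :=
    fun w hw => out w ((notmem w hw).imp (fun h => by linarith) fun h => by linarith)
  have ρabs : ∀ t : ℝ, ρ ≤ |t| → 1 ≤ |ρ⁻¹ * t| := fun t ht => by
    rw [abs_mul, abs_of_pos (by positivity), inv_mul_eq_div, le_div_iff₀ hρ]; linarith
  have χout : ∀ w : R5, (w.1, w.2.1) ∉ square X ρ → χ w = 0 := by
    intro w hw
    rcases notmem w hw with h | h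
    · have e1 := (B0 (ρ⁻¹ * w.1 + -(ρ⁻¹ * X)) (by
        rw [← sub_eq_add_neg, ← mul_sub]; exact ρabs _ h)).1
      simp [hχ, lx, e1]
    · have e1 := (B0 (ρ⁻¹ * w.2.1 + 0) (by rw [add_zero]; exact ρabs _ h)).1
      rw [add_zero] at e1
      simp [hχ, ly, e1]
  have χin : ∀ w : R5, (w.1, w.2.1) ∈ square X (3 * ρ / 4) → χ w = 1 := by
    intro w hw
    obtain ⟨h1, h2⟩ := mem_square.1 hw
    have ab : ∀ t : ℝ, |t| ≤ 3 * ρ / 4 → |ρ⁻¹ * t| ≤ 3 / 4 := fun t ht => by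
      rw [abs_mul, abs_of_pos (by positivity), inv_mul_eq_div, div_le_iff₀ hρ]; linarith
    have e1 := B1 (ρ⁻¹ * w.1 + -(ρ⁻¹ * X)) (by rw [← sub_eq_add_neg, ← mul_sub]; exact ab _ h1)
    have e2 := B1 (ρ⁻¹ * w.2.1 + 0) (by rw [add_zero]; exact ab _ h2)
    rw [add_zero] at e2
    simp [hχ, lx, ly, e1, e2]
  have χn : ∀ w, 0 ≤ χ w := fun w => mul_nonneg (Bn _) (Bn _)
  have ψn : ∀ w, 0 ≤ ψ₀ w := fun w => mul_nonneg (Bn _) (Bn _)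
  -- the amplitude of the incompatible part
  obtain ⟨Ca, hCa, bda⟩ := ba.exists_derivBound n
  obtain ⟨Cb, hCb, bdb⟩ := bb.exists_derivBound n
  obtain ⟨Cψ, hCψ, bdψ⟩ := bψ.exists_derivBound n
  -- The minimum with `δ` serves flatness, the minimum with `1` the requirement `|a| ≤ 1`.
  set τ := min δ 1 / (Ca + Cb + 1) with hτ
  have hτ0 : 0 < τ := div_pos (lt_min hδ one_pos) (by positivity)
  have hτa : τ * (Ca + Cb) ≤ min δ 1 := by
    rw [hτ, div_mul_eq_mul_div, div_le_iff₀ (by positivity)]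
    exact mul_le_mul_of_nonneg_left (by linarith) (lt_min hδ one_pos).le
  set I := ∫ z in square X (ρ / 2), (τ * b₀ (z.1, z.2, 0, 0, 0)) ^ 2 with hI
  have hIpos : 0 < I := by
    have key := integral_prod_sq_pos (s := fun x => τ * (k / 2) * B (k * x + -(k * X)))
      (t := fun y => deriv B (k * y)) (a₁ := X - ρ / 2) (b₁ := X + ρ / 2) (a₂ := -(ρ / 2))
      (b₂ := ρ / 2) (by linarith) (by linarith) (by have := sB.continuous; fun_prop)
      (by have := bB'.1.continuous; fun_prop)
      ⟨X, ⟨by linarith, by linarith⟩, by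
        rw [add_neg_cancel, B1 0 (by norm_num)]; positivity⟩
      ⟨tB / k, by
        rw [mem_Icc, ← abs_le, abs_div, abs_of_pos hk0, div_le_iff₀ hk0, hk]
        have : ρ / 2 * (4 / ρ) = 2 := by field_simp; norm_num
        linarith, by
        rw [mul_div_cancel₀ _ hk0.ne']; exact htB'⟩
    have e : ∀ z : ℝ × ℝ, (τ * b₀ (z.1, z.2, 0, 0, 0)) ^ 2
        = (τ * (k / 2) * B (k * z.1 + -(k * X)) * deriv B (k * z.2)) ^ 2 := fun z => by
      simp only [hb₀, lx, ly, add_zero]; ring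
    simp only [hI, e]
    exact key
  obtain ⟨e, he, he1, hsmall⟩ := exists_threshold (N := N) hIpos
  set r := min (ρ / 4) (e / (4 * N)) with hr
  have hr0 : 0 < r := lt_min (by positivity) (by positivity)
  have hre : 4 * N * r ≤ e := by
    calc 4 * N * r ≤ 4 * N * (e / (4 * N)) := by gcongr; exact min_le_right _ _
      _ = e := by field_simp
  set ℓ := min 1 (min (r / 5) (e * r / (20 * N))) with hℓ
  have hℓ0 : 0 < ℓ := lt_min one_pos (lt_min (by positivity) (by positivity))
  have hℓ1 : ℓ ≤ 1 := min_le_left _ _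
  have hℓr : 5 * ℓ ≤ r := by
    have : ℓ ≤ r / 5 := (min_le_right _ _).trans (min_le_left _ _)
    linarith
  have hℓe : 20 * N * ℓ ≤ e * r := by
    calc 20 * N * ℓ ≤ 20 * N * (e * r / (20 * N)) := by
          gcongr; exact (min_le_right _ _).trans (min_le_right _ _)
      _ = e * r := by field_simp
  obtain ⟨M, T, T1, T2, hM, hT⟩ := exists_cutoff hℓ0
  have bY : SmoothBdd fun w : R5 => ℓ * σ (ℓ⁻¹ * Ly w + 0) :=
    (SmoothBdd.const ℓ).mul (bσ.comp_affine Ly _ _)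
  have bZ : SmoothBdd fun w : R5 => ℓ * σ (ℓ⁻¹ * Lp w + 0) :=
    (SmoothBdd.const ℓ).mul (bσ.comp_affine Lp _ _)
  set Y : R5 → ℝ := fun w => ℓ * σ (ℓ⁻¹ * Ly w + 0) with hY
  set Z : R5 → ℝ := fun w => ℓ * σ (ℓ⁻¹ * Lp w + 0) with hZ
  obtain ⟨C, hC, hbounds⟩ := exists_packet_bound n bχ bY bZ
  -- the frequency
  obtain ⟨R, hR, hRt, hlarge⟩ := exists_frequency (4 * n + 1) (3 * N * (3 * N) * (20 * M))
    (b := ℓ ^ 2 / 128) (t := min (ℓ / 2) (min δ (e / (3 + 3 * N)) / (C + 2 * Cψ + 1)))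
    (by positivity) (by positivity)
  obtain ⟨bc, bβ, bγ, bφ⟩ := hbounds R hR
  have i1 : R⁻¹ ≤ 1 := inv_le_one_of_one_le₀ hR
  have i0 : 0 < R⁻¹ := by positivity
  have hRC : (C + 2 * Cψ) * R⁻¹ ≤ min δ (e / (3 + 3 * N)) := by
    have h1 : R⁻¹ ≤ min δ (e / (3 + 3 * N)) / (C + 2 * Cψ + 1) := hRt.trans (min_le_right _ _)
    rw [le_div_iff₀ (by positivity)] at h1
    linarith
  have hCδ : C * R⁻¹ ≤ δ := by
    have := hRC.trans (min_le_left _ _)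
    nlinarith
  have hCe : C * R⁻¹ ≤ e / (3 + 3 * N) := by
    have := hRC.trans (min_le_right _ _)
    nlinarith
  -- This will give `|c| ≤ e`: the weights `1`, `2` and `3N` bound the factors `1`, `x` and `x u_x -
  -- u` of the three parts of `c`.
  have hCe' : C * R⁻¹ * (3 + 3 * N) ≤ e := by
    rwa [le_div_iff₀ (by positivity)] at hCe
  have hR4 : R⁻¹ ^ 4 / 4 ≤ ℓ / 8 := by
    have h1 : R⁻¹ ≤ ℓ / 2 := hRt.trans (min_le_left _ _)
    have h2 : R⁻¹ ^ 4 ≤ R⁻¹ := pow_le_of_le_one i0.le i1 (by norm_num)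
    linarith
  have hR7 : R⁻¹ ^ 7 ≤ R⁻¹ := pow_le_of_le_one i0.le i1 (by norm_num)
  have hXmem : ((X, (0 : ℝ)) : ℝ × ℝ) ∈ square X (3 * ρ / 4) := by
    rw [mem_square]; simp; positivity
  have hR7e : R⁻¹ ^ 7 ≤ e := by
    -- Nothing says `1 ≤ C`, so `R⁻⁷ ≤ C R⁻¹` is read off from the bound for `R⁻⁷ χ` at the centre,
    -- where `χ = 1`.
    have h1 := bφ.norm_le (X, 0, 0, 0, 0)
    rw [χin (X, 0, 0, 0, 0) hXmem, mul_one, Real.norm_eq_abs, abs_of_pos (by positivity)] at h1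
    nlinarith
  have sp : ContDiff ℝ ∞ fun w => phase R (Z w, Y w) := by
    have := bY.1
    have := bZ.1
    unfold phase
    fun_prop
  have χψ : ∀ z r q : ℝ, χ (X, 0, z, r, q) = 1 ∧ ψ₀ (X, 0, z, r, q) = 1 := by
    intro z r q
    refine ⟨χin _ hXmem, ?_⟩
    simp only [hψ₀, lx, ly, add_neg_cancel, mul_zero, add_zero]
    rw [B1 0 (by norm_num), mul_one]
  -- The factor `2` in the last function makes `ψ - φ` equal to `R⁻⁷ > 0` at the centre.
  refine ⟨fun w => τ * a₀ w, fun w => τ * b₀ w,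
    fun w => R⁻¹ ^ (4 * n + 1) * (χ w * Real.cos (phase R (Z w, Y w))),
    fun w => χ w * beta0 R (Z w, Y w), fun w => χ w * gamma0 R (Z w, Y w),
    fun w => R⁻¹ ^ 7 * χ w, fun w => 2 * R⁻¹ ^ 7 * ψ₀ w, ?_⟩
  refine ⟨⟨contDiff_const.mul ba.1, (bda.const_mul ba.1 τ).mono ?_, fun w hw => by
      rw [(out' w hw).2.1, mul_zero]⟩,
    ⟨contDiff_const.mul bb.1, (bdb.const_mul bb.1 τ).mono ?_, fun w hw => by
      rw [(out' w hw).2.2, mul_zero]⟩,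
    ⟨contDiff_const.mul (bχ.1.mul (Real.contDiff_cos.comp sp)), bc.mono hCδ, fun w hw => by
      rw [χout w hw]; ring⟩,
    ⟨bχ.1.mul ?_, bβ.mono hCδ, fun w hw => by rw [χout w hw, zero_mul]⟩,
    ⟨bχ.1.mul ?_, bγ.mono hCδ, fun w hw => by rw [χout w hw, zero_mul]⟩,
    ⟨contDiff_const.mul bχ.1, bφ.mono hCδ, fun w hw => by rw [χout w hw, mul_zero]⟩,
    ⟨contDiff_const.mul bψ.1, (bdψ.const_mul bψ.1 _).mono ?_, fun w hw => by
      rw [(out' w hw).1, mul_zero]⟩,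
    fun w => mul_nonneg (by positivity) (χn w),
    fun z r q => ?_, fun z r q => ?_, ?_⟩
  · rw [abs_of_pos hτ0]; exact le_trans (by nlinarith) (hτa.trans (min_le_left _ _))
  · rw [abs_of_pos hτ0]; exact le_trans (by nlinarith) (hτa.trans (min_le_left _ _))
  · have := bY.1
    have := bZ.1
    unfold beta0
    fun_prop
  · have := bY.1
    have := bZ.1
    unfold gamma0
    fun_prop
  · rw [abs_of_pos (by positivity)]
    have := hRC.trans (min_le_left _ _)
    nlinarith
  · rw [(χψ z r q).1, (χψ z r q).2]
    have : 0 < R⁻¹ ^ 7 := by positivity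
    linarith
  · have hedge : |X + ρ / 2 - X| = ρ / 2 := by
      rw [add_sub_cancel_left]; exact abs_of_pos (by positivity)
    have h2 := (out (X + ρ / 2, 0, z, r, q) (Or.inl (by
      change ρ / 4 ≤ |X + ρ / 2 - X|; rw [hedge]; linarith))).1
    have h3 := χin (X + ρ / 2, 0, z, r, q) (mem_square.2 (by
      change |X + ρ / 2 - X| ≤ _ ∧ |(0 : ℝ)| ≤ _
      rw [hedge, abs_zero]
      constructor <;> linarith))
    rw [h2, h3]
    exact ⟨mul_zero _, by positivity⟩
  · intro s hs U u hU hsub hu hb heq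
    have J := jet3_of_contDiffOn hU hu
    have hsq : square X (3 * ρ / 4) ⊆ square X ρ := fun z hz => by
      rw [mem_square] at hz ⊢
      exact ⟨hz.1.trans (by linarith), hz.2.trans (by linarith)⟩
    have hc : ∀ z ∈ square X (3 * ρ / 4), lowerOrder
        (fun w => R⁻¹ ^ (4 * n + 1) * (χ w * Real.cos (phase R (Z w, Y w))))
        (fun w => χ w * beta0 R (Z w, Y w)) (fun w => χ w * gamma0 R (Z w, Y w)) (jet u z)
          = packetCoeff σ ℓ R (R⁻¹ ^ (4 * n + 1)) z.1 z.2 (u z) (dx u z) := by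
      intro z hz
      have h1 := χin (jet u z) hz
      simp only [lowerOrder, h1, packetCoeff, one_mul, hY, hZ, ly, lp, add_zero, inv_mul_eq_div]
      rfl
    have hf1 : ∀ z ∈ square X (3 * ρ / 4), -R⁻¹ ^ 7 ≤ s * (2 * R⁻¹ ^ 7 * ψ₀ (jet u z))
        - R⁻¹ ^ 7 * χ (jet u z) := by
      intro z hz
      rw [χin (jet u z) hz, mul_one]
      have : 0 ≤ s * (2 * R⁻¹ ^ 7 * ψ₀ (jet u z)) := by
        have := ψn (jet u z)
        rcases hs with rfl | rfl <;> positivity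
      linarith
    refine J.false_of_solution (h := fun z => τ * ψ₀ (z.1, z.2, 0, 0, 0))
      (a := fun z => τ * a₀ (z.1, z.2, 0, 0, 0)) (b := fun z => τ * b₀ (z.1, z.2, 0, 0, 0))
      (f := fun z => s * (2 * R⁻¹ ^ 7 * ψ₀ (jet u z)) - R⁻¹ ^ 7 * χ (jet u z)) (η := e)
      hT hσ hM.le hℓ0 hℓ1 hR hR4 (by positivity) hN he hr0 hre hℓr hℓe he.le he1 hX hρ1
      (min_le_left _ _) (hsq.trans hsub) (fun z hz => hb z (hsq hz)) (fun z => ?_) ?_ ?_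
      (fun z => ?_) (fun z hz => ?_) hc (fun z hz => ?_) hR7e hf1 (fun z hz hz' => ?_)
      (fun z hz => heq z (hsq hz)) ?_ hsmall
    · have h1 : HasDerivAt (fun x => B (k * x + -(k * X)))
          (deriv B (k * z.1 + -(k * X)) * (k * 1)) z.1 :=
        (hdB _).comp z.1 (((hasDerivAt_id z.1).const_mul k).add_const _)
      have h2 : HasDerivAt (fun y => B (k * y + 0)) (deriv B (k * z.2 + 0) * (k * 1)) z.2 :=
        (hdB _).comp z.2 (((hasDerivAt_id z.2).const_mul k).add_const _)
      refine ((HasGrad.const z τ).mul (HasGrad.prod_mul h1 h2)).congr_grad ?_ ?_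
      · simp only [ha₀, lx, ly]; ring
      · simp only [hb₀, lx, ly]; ring
    · have := ba.1.continuous
      fun_prop
    · have := bb.1.continuous
      fun_prop
    · have := (bda.const_mul ba.1 τ).norm_le (z.1, z.2, 0, 0, 0)
      rw [abs_of_pos hτ0] at this
      exact this.trans (le_trans (by nlinarith) (hτa.trans (min_le_right _ _)))
    · obtain ⟨h1, h2, h3⟩ := out (z.1, z.2, 0, 0, 0) hz
      simp only [h1, h2, h3, mul_zero, and_self]
    · have h1 := bc.norm_le (jet u z)
      have h2 := bβ.norm_le (jet u z)
      have h3 := bγ.norm_le (jet u z)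
      rw [Real.norm_eq_abs] at h1 h2 h3
      have hx : |z.1| ≤ 2 := by
        have t := abs_add_le (z.1 - X) X
        rw [sub_add_cancel] at t
        have := (mem_square.1 hz).1
        linarith
      obtain ⟨hu0, hp0, -⟩ := hb z (hsq hz)
      have hv : |z.1 * dx u z - u z| ≤ 3 * N := by
        have : |z.1 * dx u z| ≤ 2 * N := by
          rw [abs_mul]; exact mul_le_mul hx hp0 (abs_nonneg _) (by norm_num)
        linarith [abs_sub (z.1 * dx u z) (u z)]
      have hCR : 0 ≤ C * R⁻¹ := by positivity
      refine le_trans ?_ hCe'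
      simp only [lowerOrder]
      refine (abs_add_le _ _).trans ((add_le_add (abs_add_le _ _) le_rfl).trans ?_)
      have m1 := mul_le_mul h2 hx (abs_nonneg _) hCR
      have m2 := mul_le_mul h3 hv (abs_nonneg _) hCR
      rw [← abs_mul] at m1 m2
      calc _ ≤ C * R⁻¹ + C * R⁻¹ * 2 + C * R⁻¹ * (3 * N) := add_le_add (add_le_add h1 m1) m2
        _ = C * R⁻¹ * (3 + 3 * N) := by ring
    · have h2 := (out (jet u z) hz').1
      simp only [h2, χin (jet u z) hz]
      ring
    · calc _ = 3 * N * (3 * N) * (20 * M) * R ^ 4 * Real.exp (-(ℓ ^ 2 / 128 * R)) := by ring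
        _ < _ := hlarge

/-! ### Summation over the squares -/

/-- The squares with centre `(2⁻ⁿ, 0)` and half side `2⁻ⁿ / 8` are pairwise disjoint. -/
theorem notMem_square_of_ne {m n : ℕ} (hmn : m ≠ n) {z : ℝ × ℝ}
    (hz : z ∈ square ((1 / 2) ^ n) ((1 / 2) ^ n / 8)) :
    z ∉ square ((1 / 2) ^ m) ((1 / 2) ^ m / 8) := by
  intro hz'
  have h1 := abs_le.1 (mem_square.1 hz).1
  have h2 := abs_le.1 (mem_square.1 hz').1
  have key : ∀ i j : ℕ, i < j → ((1 : ℝ) / 2) ^ j ≤ (1 / 2) ^ i * (1 / 2) := fun i j hij => by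
    rw [← pow_succ]
    exact pow_le_pow_of_le_one (by norm_num) (by norm_num) hij
  have pm : (0 : ℝ) < (1 / 2) ^ m := by positivity
  have pn : (0 : ℝ) < (1 / 2) ^ n := by positivity
  rcases hmn.lt_or_gt with h | h
  · have := key _ _ h
    linarith
  · have := key _ _ h
    linarith

theorem zero_notMem_square (n : ℕ) :
    ((0, 0) : ℝ × ℝ) ∉ square ((1 / 2) ^ n) ((1 / 2) ^ n / 8) := by
  intro h
  have h1 := abs_le.1 (mem_square.1 h).1
  have pn : (0 : ℝ) < (1 / 2) ^ n := by positivity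
  simp only at h1
  linarith

section Series

variable {g : ℕ → R5 → ℝ}
  (hg : ∀ n, IsFlat n ((1 / 2) ^ n) ((1 / 2) ^ n / 8) ((1 / 2) ^ n) (g n))
include hg

/-- For each order `k`, all but the first `k` terms have `k`-th derivative at most `2⁻ⁱ`, so the
differentiated series converges uniformly. -/
theorem contDiff_tsum_of_isFlat : ContDiff ℝ ∞ fun w => ∑' n, g n w := by
  refine contDiff_tsum_of_eventually (v := fun _ i => (1 / 2) ^ i) (fun i => (hg i).smooth)
    (fun _ _ => summable_geometric_two) fun k _ => ?_
  rw [Nat.cofinite_eq_atTop]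
  filter_upwards [Filter.eventually_ge_atTop k] with i hi x
  exact (hg i).bound k hi x

theorem tsum_eq_of_mem_square {n : ℕ} {w : R5}
    (hw : (w.1, w.2.1) ∈ square ((1 / 2) ^ n) ((1 / 2) ^ n / 8)) :
    ∑' m, g m w = g n w :=
  tsum_eq_single n fun m hm => (hg m).support w (notMem_square_of_ne hm hw)

theorem tsum_eq_zero_at_origin (z r q : ℝ) : ∑' m, g m (0, 0, z, r, q) = 0 := by
  have : ∀ m, g m (0, 0, z, r, q) = 0 := fun m => (hg m).support _ (zero_notMem_square m)
  simp only [this, tsum_zero]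

end Series

theorem contDiff_lowerOrder {c₀ β γ : R5 → ℝ} (hc : ContDiff ℝ ∞ c₀) (hβ : ContDiff ℝ ∞ β)
    (hγ : ContDiff ℝ ∞ γ) : ContDiff ℝ ∞ (lowerOrder c₀ β γ) := by
  unfold lowerOrder
  fun_prop

/-- A neighbourhood of the origin contains all but finitely many of the squares. -/
theorem exists_square_subset {U : Set (ℝ × ℝ)} (hU : IsOpen U) (h0 : (0, 0) ∈ U)
    {u : ℝ × ℝ → ℝ} (hu : ContDiffOn ℝ 3 u U) :
    ∃ n : ℕ, square ((1 / 2) ^ n) ((1 / 2) ^ n / 8) ⊆ U ∧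
      JetBound (n + 1) (square ((1 / 2) ^ n) ((1 / 2) ^ n / 8)) u := by
  have J := jet3_of_contDiffOn hU hu
  obtain ⟨c0, c1, c2, c3, c4, c5⟩ := J.continuousOn_all
  obtain ⟨ε, hε, hball⟩ := Metric.nhds_basis_closedBall.mem_iff.1 (hU.mem_nhds h0)
  have bd : ∀ f : ℝ × ℝ → ℝ, ContinuousOn f U →
      ∃ C, ∀ z ∈ Metric.closedBall ((0, 0) : ℝ × ℝ) ε, |f z| ≤ C := fun f hf =>
    (isCompact_closedBall _ _).exists_bound_of_continuousOn (hf.mono hball)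
  obtain ⟨C0, h0⟩ := bd _ c0
  obtain ⟨C1, h1⟩ := bd _ c1
  obtain ⟨C2, h2⟩ := bd _ c2
  obtain ⟨C3, h3⟩ := bd _ c3
  obtain ⟨C4, h4⟩ := bd _ c4
  obtain ⟨C5, h5⟩ := bd _ c5
  obtain ⟨C6, h6⟩ := bd _ J.cEx
  obtain ⟨C7, h7⟩ := bd _ J.cEy
  -- The bounds of the given solution are fixed while the threshold `n + 1` of the squares grows, so
  -- some square excludes it.
  have large : ∀ C : ℝ, ∀ᶠ n : ℕ in Filter.atTop, C ≤ (n : ℝ) + 1 := fun C =>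
    (Filter.tendsto_atTop_add_const_right _ 1 tendsto_natCast_atTop_atTop).eventually_ge_atTop C
  have small : ∀ᶠ n : ℕ in Filter.atTop, ((1 : ℝ) / 2) ^ n < ε / 2 :=
    (tendsto_pow_atTop_nhds_zero_of_lt_one (by norm_num) (by norm_num)).eventually_lt_const
      (by positivity)
  obtain ⟨n, hn, l0, l1, l2, l3, l4, l5, l6, l7⟩ :=
    (small.and <| (large C0).and <| (large C1).and <| (large C2).and <| (large C3).and <|
      (large C4).and <| (large C5).and <| (large C6).and (large C7)).exists
  have hsub : square ((1 / 2) ^ n) ((1 / 2) ^ n / 8) ⊆ Metric.closedBall ((0, 0) : ℝ × ℝ) ε := by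
    intro z hz
    obtain ⟨hx, hy⟩ := mem_square.1 hz
    have pn : (0 : ℝ) < (1 / 2) ^ n := by positivity
    rw [Metric.mem_closedBall, Prod.dist_eq, max_le_iff, Real.dist_eq, Real.dist_eq]
    simp only [sub_zero]
    have hx' := abs_le.1 hx
    exact ⟨abs_le.2 ⟨by linarith, by linarith⟩, hy.trans (by linarith)⟩
  exact ⟨n, hsub.trans hball, fun z hz =>
    ⟨(h0 z (hsub hz)).trans l0, (h1 z (hsub hz)).trans l1, (h2 z (hsub hz)).trans l2,
      (h3 z (hsub hz)).trans l3, (h4 z (hsub hz)).trans l4, (h5 z (hsub hz)).trans l5,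
      (h6 z (hsub hz)).trans l6, (h7 z (hsub hz)).trans l7⟩⟩

theorem frequently_of_tendsto_zero {x : ℕ → ℝ} (hx : Filter.Tendsto x Filter.atTop (𝓝 0))
    {P : R5 → Prop} {z r q : ℝ} (h : ∀ n, P (x n, 0, z, r, q)) :
    ∃ᶠ w in 𝓝 ((0, 0, z, r, q) : R5), P w :=
  (hx.prodMk_nhds (tendsto_const_nhds (x := ((0, z, r, q) : ℝ × ℝ × ℝ × ℝ)))).frequently
    (Filter.Eventually.of_forall h).frequently

end MongeAmpere

open MongeAmpere in
theorem mainTheorem1 :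
    ∃ a b c : MongeAmpere.R5 → ℝ,
      ContDiff ℝ ∞ a ∧ ContDiff ℝ ∞ b ∧ ContDiff ℝ ∞ c ∧
      (∃ f : MongeAmpere.R5 → ℝ, ContDiff ℝ ∞ f ∧ MongeAmpere.IsSignChanging f ∧
        MongeAmpere.NoLocalC3Solution a b c f) ∧
      (∃ f : MongeAmpere.R5 → ℝ, ContDiff ℝ ∞ f ∧ MongeAmpere.IsDegenerateHyperbolic f ∧
        MongeAmpere.NoLocalC3Solution a b c f) := by
  have p0 : ∀ n : ℕ, (0 : ℝ) < (1 / 2) ^ n := fun n => by positivity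
  have p1 : ∀ n : ℕ, ((1 : ℝ) / 2) ^ n ≤ 1 := fun n => pow_le_one₀ (by norm_num) (by norm_num)
  have ex : ∀ n : ℕ, ∃ a b c₀ β γ φ ψ, IsObstruction n ((1 / 2) ^ n) ((1 / 2) ^ n / 8)
      ((1 / 2) ^ n) (n + 1) a b c₀ β γ φ ψ := fun n =>
    exists_obstruction n (by linarith [p0 n]) (by linarith [p1 n])
      (by rw [abs_of_pos (p0 n)]; exact p1 n) (p0 n) (by linarith [n.cast_nonneg (α := ℝ)])
  choose a b c₀ β γ φ ψ ob using ex
  have xlim : Filter.Tendsto (fun n : ℕ => ((1 : ℝ) / 2) ^ n) Filter.atTop (𝓝 0) :=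
    tendsto_pow_atTop_nhds_zero_of_lt_one (by norm_num) (by norm_num)
  have xlim' : Filter.Tendsto (fun n : ℕ => ((1 : ℝ) / 2) ^ n + (1 / 2) ^ n / 8 / 2)
      Filter.atTop (𝓝 0) := by
    simpa using xlim.add ((xlim.div_const 8).div_const 2)
  have centre : ∀ n : ℕ, (((1 / 2) ^ n, 0) : ℝ × ℝ) ∈ square ((1 / 2) ^ n) ((1 / 2) ^ n / 8) :=
    fun n => mem_square.2 (by
      have := p0 n
      simp only [sub_self, abs_zero]
      constructor <;> linarith)
  have edge : ∀ n : ℕ, (((1 / 2) ^ n + (1 / 2) ^ n / 8 / 2, 0) : ℝ × ℝ) ∈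
      square ((1 / 2) ^ n) ((1 / 2) ^ n / 8) := fun n => mem_square.2 (by
    have := p0 n
    simp only [add_sub_cancel_left, abs_zero]
    rw [abs_of_pos (by linarith)]
    constructor <;> linarith)
  have fφ := fun n => (ob n).flat_φ
  have fψ := fun n => (ob n).flat_ψ
  -- With `f = s ψ - φ`, the value `s = 1` gives the mixed type and `s = 0` the degenerate
  -- hyperbolic type.
  have none : ∀ s : ℝ, s = 0 ∨ s = 1 → NoLocalC3Solution (fun w => ∑' n, a n w)
      (fun w => ∑' n, b n w) (lowerOrder (fun w => ∑' n, c₀ n w) (fun w => ∑' n, β n w)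
        fun w => ∑' n, γ n w) fun w => s * ∑' n, ψ n w - ∑' n, φ n w := by
    rintro s hs U hU h0 ⟨u, hu, heq⟩
    obtain ⟨n, hn, hb⟩ := exists_square_subset hU h0 hu
    refine (ob n).no_solution s hs U u hU hn hu hb fun z hz => ?_
    have h := heq z (hn hz)
    have hw : ((jet u z).1, (jet u z).2.1) ∈ square ((1 / 2) ^ n) ((1 / 2) ^ n / 8) := hz
    simp only [lowerOrder] at h ⊢
    rwa [tsum_eq_of_mem_square (fun n => (ob n).flat_a) hw,
      tsum_eq_of_mem_square (fun n => (ob n).flat_b) hw,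
      tsum_eq_of_mem_square (fun n => (ob n).flat_c) hw,
      tsum_eq_of_mem_square (fun n => (ob n).flat_β) hw,
      tsum_eq_of_mem_square (fun n => (ob n).flat_γ) hw,
      tsum_eq_of_mem_square fφ hw, tsum_eq_of_mem_square fψ hw] at h
  have sφ := contDiff_tsum_of_isFlat fφ
  have sψ := contDiff_tsum_of_isFlat fψ
  refine ⟨_, _, _, contDiff_tsum_of_isFlat fun n => (ob n).flat_a,
    contDiff_tsum_of_isFlat fun n => (ob n).flat_b,
    contDiff_lowerOrder (contDiff_tsum_of_isFlat fun n => (ob n).flat_c)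
      (contDiff_tsum_of_isFlat fun n => (ob n).flat_β)
      (contDiff_tsum_of_isFlat fun n => (ob n).flat_γ),
    ⟨_, (contDiff_const.mul sψ).sub sφ, fun z r q => ⟨?_, ?_⟩, none 1 (Or.inr rfl)⟩,
    ⟨_, (contDiff_const.mul sψ).sub sφ, ⟨fun w => ?_, fun z r q => ⟨?_, ?_⟩⟩,
      none 0 (Or.inl rfl)⟩⟩
  -- Positive values occur at the centres of the squares; negative ones at the points shifted by
  -- half the half side, where `ψ` vanishes.
  · refine frequently_of_tendsto_zero xlim fun n => ?_
    have e₁ := tsum_eq_of_mem_square fφ (w := (_, _, z, r, q)) (centre n)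
    have e₂ := tsum_eq_of_mem_square fψ (w := (_, _, z, r, q)) (centre n)
    linarith [(ob n).φ_lt_ψ z r q]
  · refine frequently_of_tendsto_zero xlim' fun n => ?_
    have e₁ := tsum_eq_of_mem_square fφ (w := (_, _, z, r, q)) (edge n)
    have e₂ := tsum_eq_of_mem_square fψ (w := (_, _, z, r, q)) (edge n)
    linarith [(ob n).ψ_lt_φ z r q]
  · have : 0 ≤ ∑' n, φ n w := tsum_nonneg fun n => (ob n).φ_nonneg w
    linarith
  · have := tsum_eq_zero_at_origin fφ z r q
    linarith
  · refine frequently_of_tendsto_zero xlim' fun n => ?_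
    have e₁ := tsum_eq_of_mem_square fφ (w := (_, _, z, r, q)) (edge n)
    linarith [((ob n).ψ_lt_φ z r q).2]
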